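/- **Setting.** Place $q$ qubits at each site of the chain $\Lambda=\mathbb Z$ and let $R=\mathbb F_2[\mathbb Z]=\mathbb F_2[x,x^{-1}]$, with antipode $x\mapsto\bar x=x^{-1}$. Finitely supported Pauli operators up to phase form the Pauli module $P=R^{2q}$ (upper half: $\sigma_x$-part, lower half: $\sigma_z$-part; multiplication by $x$ is translation by one site). A *code Hamiltonian* is $H=-\sum_{g\in\mathbb Z}(h_{1,g}+\dots+h_{t,g})$, where the $h_{i,g}$ are finitely supported Hermitian Pauli operators that commute with each other, are translation-invariant up to signs, and are frustration-free (they have a common $+1$ eigenvector). If the columns of the $2q\times t$ matrix $\sigma$ represent $h_{1,0},\dots,h_{t,0}$, the *stabilizer module* of $H$ is $\operatorname{im}\sigma\subseteq P$. Let $M^\dagger$ be the transpose of $M$ with the antipode applied to each entry, and $\lambda_q=\begin{pmatrix}0&\mathrm{id}\\-\mathrm{id}&0\end{pmatrix}$. $H$ is *exact* if $\ker(\sigma^\dagger\lambda_q)=\operatorname{im}\sigma$. Two code Hamiltonians are *equivalent* if their stabilizer modules become the same under finite compositions of: symplectic transformations $S\mapsto TS$ with $T^\dagger\lambda_qT=\lambda_q$;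 coarse-graining, that is, restriction of scalars from $R$ to $\mathbb F_2[x^{c},x^{-c}]$ with $c\ge1$, so that $c$ consecutive sites become one site with $cq$ qubits; tensoring an ancilla, that is, adding to each site a qubit with the term $-\sigma_z$. For $L\ge1$ let $H(L)$ be the Hamiltonian obtained from $H$ by periodic boundary conditions on the ring of $L$ sites, with any choice of the signs of the terms for which it is frustration-free, and let $\Pi_L$ be its ground space projector. $H(L)$ is *topologically ordered* if $\Pi_LO\Pi_L\propto\Pi_L$ for every operator $O$ supported on $\lfloor L/2\rfloor$ consecutive sites. (This holds trivially if the ground state is unique.) **Theorem.** Let $H$ be a code Hamiltonian on the chain $\Lambda=\mathbb Z$. 1. There are $k,m,f\ge0$ such that $H$ is equivalent to $k$ copies of the Ising model $-\sum_n\sigma_z^{(n)}\sigma_z^{(n+1)}$ plus non-interacting qubits, namely, at each site, $m$ qubits with the term $-\sigma_z$ and $f$ qubits on which no term acts. 2. In particular, degenerate Hamiltonians are never topologically ordered: there is $L_0$, depending on $H$, such that for every $L\ge L_0$, if the ground space of $H(L)$ has dimension greater than one, then $H(L)$ is not topologically ordered. 3. If $H$ is not equivalent to a Hamiltonian that consists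 only of qubits with the single-qubit term $-\sigma_z$, then $H$ is not exact, and there are arbitrarily large $L$ such that $H(L)$ is degenerate and not topologically ordered. -/

import Mathlib

noncomputable section

namespace PauliCode

/-! ### The Pauli module -/

/-- The Pauli module `P = R^{2q}` over the group algebra `R = 𝔽₂[Λ]`, for `q` qubits at each site of
the lattice `Λ`.  The components `Sum.inl i` form the `σ_x`-part, the components `Sum.inr i` the
`σ_z`-part. -/
abbrev PauliModule (Λ : Type) (q : ℕ) : Type :=
  Fin q ⊕ Fin q → AddMonoidAlgebra (ZMod 2) Λ

/-- Computational basis states: a bit for each qubit in `Λ × {1, …, q}`. -/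
abbrev Config (Λ : Type) (q : ℕ) : Type := Λ → Fin q → ZMod 2

/-- Wave functions.  For finite `Λ` this is the Hilbert space of the qubits; for infinite `Λ` it is
a faithful representation of the algebra of local operators. -/
abbrev WaveFun (Λ : Type) (q : ℕ) : Type := Config Λ q → ℂ

/-- `∏_{(g,i)} (σ_x^{(g,i)})^{a_{i,g}}`, which maps the basis state `|s⟩` to `|s + a⟩`. -/
def pauliX {Λ : Type} {q : ℕ} (a : Fin q → AddMonoidAlgebra (ZMod 2) Λ) :
    Module.End ℂ (WaveFun Λ q) where
  toFun ψ := fun s => ψ (fun g i => s g i - (a i).coeff g)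
  map_add' _ _ := rfl
  map_smul' _ _ := rfl

/-- The parity `∑_{(g,i)} b_{i,g} s_{g,i}`. -/
def parity {Λ : Type} {q : ℕ} (b : Fin q → AddMonoidAlgebra (ZMod 2) Λ) (s : Config Λ q) : ZMod 2 :=
  ∑ i, (b i).coeff.sum fun g c => c * s g i

/-- `∏_{(g,i)} (σ_z^{(g,i)})^{b_{i,g}}`, which maps the basis state `|s⟩` to `(-1)^{b·s} |s⟩`. -/
def pauliZ {Λ : Type} {q : ℕ} (b : Fin q → AddMonoidAlgebra (ZMod 2) Λ) :
    Module.End ℂ (WaveFun Λ q) where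
  toFun ψ := fun s => (-1 : ℂ) ^ (parity b s).val * ψ s
  map_add' _ _ := by ext s; simp [mul_add]
  map_smul' _ _ := by ext s; simp [mul_left_comm]

/-- The Pauli operator (up to phase) represented by `v = (a, b)`. -/
def pauliOp {Λ : Type} {q : ℕ} (v : PauliModule Λ q) : Module.End ℂ (WaveFun Λ q) :=
  pauliX (fun i => v (Sum.inl i)) * pauliZ (fun i => v (Sum.inr i))

/-- Translation of an element of the Pauli module by `g`: multiplication by the monomial `x^g`. -/
def translate {Λ : Type} [AddCommGroup Λ] {q : ℕ} (g : Λ) (v : PauliModule Λ q) :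
    PauliModule Λ q :=
  (AddMonoidAlgebra.single g 1 : AddMonoidAlgebra (ZMod 2) Λ) • v

/-! ### Code Hamiltonians -/

/-- A code Hamiltonian `H = - ∑_{g ∈ Λ} (h_{1,g} + ⋯ + h_{t,g})` with `q` qubits per site and `t`
interaction types.  The term `h_{i,g}` is a scalar multiple of the Pauli operator represented by the
translate by `g` of the `i`-th column of `gen`.  As it squares to one, the scalar is determined up
to sign, so that the terms are Hermitian Pauli operators, translation-invariant up to signs. -/
structure CodeHamiltonian (Λ : Type) [AddCommGroup Λ] (q t : ℕ) where
  /-- The generating matrix `σ`. -/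
  gen : Matrix (Fin q ⊕ Fin q) (Fin t) (AddMonoidAlgebra (ZMod 2) Λ)
  /-- The scalar in front of the Pauli operator. -/
  phase : Fin t → Λ → ℂ
  /-- The terms `h_{i,g}`. -/
  term : Fin t → Λ → Module.End ℂ (WaveFun Λ q)
  term_eq : ∀ i g, term i g = phase i g • pauliOp (translate g (gen.col i))
  term_sq : ∀ i g, term i g * term i g = 1
  commuting : ∀ i g j h, Commute (term i g) (term j h)
  frustrationFree : ∃ ψ : WaveFun Λ q, ψ ≠ 0 ∧ ∀ i g, term i g ψ = ψ

/-- The stabilizer module: the submodule of the Pauli module generated by the columns of `σ`. -/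
def CodeHamiltonian.stabilizerModule {Λ : Type} [AddCommGroup Λ] {q t : ℕ}
    (H : CodeHamiltonian Λ q t) :
    Submodule (AddMonoidAlgebra (ZMod 2) Λ) (PauliModule Λ q) :=
  Submodule.span _ (Set.range H.gen.col)

/-! ### Equivalence of one-dimensional code Hamiltonians -/

/-- `M ↦ M†`: transposition followed by the entrywise antipode map `x ↦ x⁻¹`. -/
def dagger {m n : Type} (M : Matrix m n (LaurentPolynomial (ZMod 2))) :
    Matrix n m (LaurentPolynomial (ZMod 2)) :=
  M.transpose.map LaurentPolynomial.invert

/-- The matrix `λ_q` of the symplectic form. -/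
def lam (q : ℕ) : Matrix (Fin q ⊕ Fin q) (Fin q ⊕ Fin q) (LaurentPolynomial (ZMod 2)) :=
  Matrix.fromBlocks 0 1 (-1) 0

/-- `T† λ_q T = λ_q`.  Such a (square) matrix is invertible. -/
def IsSymplectic {q : ℕ}
    (T : Matrix (Fin q ⊕ Fin q) (Fin q ⊕ Fin q) (LaurentPolynomial (ZMod 2))) : Prop :=
  dagger T * lam q * T = lam q

/-- The Laurent polynomial whose coefficient at `n` is the coefficient of `f` at `c n + r`. -/
def subsample (c : ℕ) [NeZero c] (r : Fin c) (f : LaurentPolynomial (ZMod 2)) :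
    LaurentPolynomial (ZMod 2) :=
  AddMonoidAlgebra.ofCoeff (Finsupp.comapDomain (fun n : ℤ => (c : ℤ) * n + (r : ℕ)) f.coeff
    (by
      intro a _ b _ h
      have hc : (c : ℤ) ≠ 0 := by exact_mod_cast NeZero.ne c
      exact mul_left_cancel₀ hc (add_right_cancel h)))

/-- Coarse-graining of the chain `ℤ` by its subgroup `c ℤ` of index `c`: the sites
`c n, c n + 1, …, c n + c - 1` become the new site `n`, and the new qubit `(r, i)` at site `n` is the
old qubit `i` at site `c n + r`. -/
def coarseGrain (c : ℕ) [NeZero c] {q : ℕ} (v : PauliModule ℤ q) : PauliModule ℤ (c * q) :=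
  Sum.elim
    (fun k => subsample c (finProdFinEquiv.symm k).1 (v (Sum.inl (finProdFinEquiv.symm k).2)))
    (fun k => subsample c (finProdFinEquiv.symm k).1 (v (Sum.inr (finProdFinEquiv.symm k).2)))

/-- Tensoring an ancilla: `w` belongs to the new module iff its part on the old qubits belongs to
`S` and its `σ_x`-part on the new qubit vanishes (its `σ_z`-part there is arbitrary). -/
def addAncilla {q : ℕ} (S : Submodule (LaurentPolynomial (ZMod 2)) (PauliModule ℤ q)) :
    Submodule (LaurentPolynomial (ZMod 2)) (PauliModule ℤ (q + 1)) :=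
  S.comap (LinearMap.funLeft _ _ (Sum.map Fin.castSucc Fin.castSucc)) ⊓
    LinearMap.ker (LinearMap.proj (Sum.inl (Fin.last q)))

/-- A number of qubits per site of the chain `ℤ` together with a submodule of the Pauli module. -/
abbrev ChainModule : Type :=
  Σ q : ℕ, Submodule (LaurentPolynomial (ZMod 2)) (PauliModule ℤ q)

/-- The three elementary moves on stabilizer modules. -/
inductive Move : ChainModule → ChainModule → Prop
  | symplectic {q : ℕ} (S : Submodule (LaurentPolynomial (ZMod 2)) (PauliModule ℤ q))
      (T : Matrix (Fin q ⊕ Fin q) (Fin q ⊕ Fin q) (LaurentPolynomial (ZMod 2)))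
      (hT : IsSymplectic T) : Move ⟨q, S⟩ ⟨q, S.map T.mulVecLin⟩
  | coarseGraining {q : ℕ} (c : ℕ) [NeZero c]
      (S : Submodule (LaurentPolynomial (ZMod 2)) (PauliModule ℤ q))
      (S' : Submodule (LaurentPolynomial (ZMod 2)) (PauliModule ℤ (c * q)))
      (hS' : (S' : Set (PauliModule ℤ (c * q))) = coarseGrain c '' (S : Set (PauliModule ℤ q))) :
      Move ⟨q, S⟩ ⟨c * q, S'⟩
  | ancilla {q : ℕ} (S : Submodule (LaurentPolynomial (ZMod 2)) (PauliModule ℤ q)) :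
      Move ⟨q, S⟩ ⟨q + 1, addAncilla S⟩

/-- Two code Hamiltonians on the chain are equivalent if their stabilizer modules become the same
under finite compositions of symplectic transformations, coarse-grainings and tensoring ancillas. -/
def Equivalent {q t q' t' : ℕ} (H : CodeHamiltonian ℤ q t) (H' : CodeHamiltonian ℤ q' t') : Prop :=
  Relation.Join (Relation.ReflTransGen Move)
    (⟨q, H.stabilizerModule⟩ : ChainModule) (⟨q', H'.stabilizerModule⟩ : ChainModule)

/-! ### Ising chains and non-interacting qubits -/

/-- The generating matrix with one column for each of the first `k + m` qubits: the column of qubit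
`j` has the single nonzero entry `1 + x` (if `j < k`) or `1` (if `k ≤ j < k + m`), in the `σ_z`-part
of that qubit. -/
def isingGen (k m f : ℕ) :
    Matrix (Fin (k + m + f) ⊕ Fin (k + m + f)) (Fin (k + m)) (LaurentPolynomial (ZMod 2)) :=
  Matrix.of fun a j =>
    match a with
    | Sum.inl _ => 0
    | Sum.inr i =>
      if i = Fin.castAdd f j then
        (if (j : ℕ) < k then 1 + LaurentPolynomial.T 1 else 1)
      else 0

lemma pauliOp_apply_of_inl_eq_zero {Λ : Type} {q : ℕ} (v : PauliModule Λ q)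
    (hv : ∀ i, v (Sum.inl i) = 0) (ψ : WaveFun Λ q) (s : Config Λ q) :
    pauliOp v ψ s = (-1 : ℂ) ^ (parity (fun i => v (Sum.inr i)) s).val * ψ s := by
  simp [pauliOp, pauliX, pauliZ, hv]

lemma translate_isingGen_inl (k m f : ℕ) (j : Fin (k + m)) (g : ℤ) (i : Fin (k + m + f)) :
    translate g ((isingGen k m f).col j) (Sum.inl i) = 0 := by
  simp [translate, isingGen, Matrix.col]

/-- The Hamiltonian of `k` copies of the Ising chain `-∑_n σ_z^{(n)} σ_z^{(n+1)}`, together with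
non-interacting qubits: at each site there are `m` qubits with the single-qubit term
`-σ_z`, and `f` qubits on which no term of the Hamiltonian acts. -/
def isingChains (k m f : ℕ) : CodeHamiltonian ℤ (k + m + f) (k + m) where
  gen := isingGen k m f
  phase _ _ := 1
  term j g := pauliOp (translate g ((isingGen k m f).col j))
  term_eq _ _ := by simp
  term_sq j g := by
    ext1 ψ
    funext s
    simp only [Module.End.mul_apply, Module.End.one_apply]
    rw [pauliOp_apply_of_inl_eq_zero _ (translate_isingGen_inl k m f j g),
      pauliOp_apply_of_inl_eq_zero _ (translate_isingGen_inl k m f j g), ← mul_assoc, ← mul_pow]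
    simp
  commuting i g j h := by
    ext1 ψ
    funext s
    simp only [Module.End.mul_apply]
    rw [pauliOp_apply_of_inl_eq_zero _ (translate_isingGen_inl k m f i g),
      pauliOp_apply_of_inl_eq_zero _ (translate_isingGen_inl k m f j h),
      pauliOp_apply_of_inl_eq_zero _ (translate_isingGen_inl k m f j h),
      pauliOp_apply_of_inl_eq_zero _ (translate_isingGen_inl k m f i g)]
    ring
  frustrationFree := by
    classical
    refine ⟨Pi.single 0 1, by simp, fun j g => ?_⟩
    funext s
    rw [pauliOp_apply_of_inl_eq_zero _ (translate_isingGen_inl k m f j g)]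
    by_cases hs : s = 0
    · subst hs
      simp [parity, Finsupp.sum]
    · simp [hs]

/-! ### Topological order -/

/-- `H` is exact: the sequence `G → P → E` with maps `σ` and `ε = σ† λ_q` is exact, that is,
`(im σ)^⊥ = im σ`. -/
def CodeHamiltonian.IsExact {q t : ℕ} (H : CodeHamiltonian ℤ q t) : Prop :=
  Function.Exact (H.gen.mulVec) ((dagger H.gen * lam q).mulVec)

/-- `H'` is the Hamiltonian `H(L)`, for some choice of the signs of the terms, that `H` yields under
periodic boundary conditions on the ring of `L` sites: its generating matrix is the reduction of
that of `H` to `𝔽₂[ℤ/L] = 𝔽₂[x, x⁻¹]/(x^L - 1)`. -/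
def IsPeriodic {q t : ℕ} (H : CodeHamiltonian ℤ q t) (L : ℕ)
    (H' : CodeHamiltonian (ZMod L) q t) : Prop :=
  H'.gen = H.gen.map
    (AddMonoidAlgebra.mapDomainRingHom (ZMod 2) (Int.castAddHom (ZMod L)))

/-- The ground space of a (frustration-free) code Hamiltonian: the common `+1` eigenspace of its
terms. -/
def CodeHamiltonian.groundSpace {Λ : Type} [AddCommGroup Λ] {q t : ℕ}
    (H : CodeHamiltonian Λ q t) : Submodule ℂ (WaveFun Λ q) :=
  ⨅ (i : Fin t) (g : Λ), LinearMap.eqLocus (H.term i g) LinearMap.id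

/-- The ground space inside the Hilbert space of a finite system. -/
def CodeHamiltonian.groundSpaceHilbert {L : ℕ} [NeZero L] {q t : ℕ}
    (H : CodeHamiltonian (ZMod L) q t) :
    Submodule ℂ (EuclideanSpace ℂ (Config (ZMod L) q)) :=
  H.groundSpace.comap (WithLp.linearEquiv 2 ℂ (WaveFun (ZMod L) q)).toLinearMap

/-- The ground space projector `Π_L`. -/
def CodeHamiltonian.groundProj {L : ℕ} [NeZero L] {q t : ℕ} (H : CodeHamiltonian (ZMod L) q t) :
    EuclideanSpace ℂ (Config (ZMod L) q) →L[ℂ] EuclideanSpace ℂ (Config (ZMod L) q) :=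
  H.groundSpaceHilbert.starProjection

open Classical in
/-- The operator `O` (as a matrix in the computational basis) is supported on the set `A` of sites:
it is the tensor product of an operator `M` on the qubits of `A` and the identity on the others. -/
def SupportedOn {Λ : Type} {q : ℕ} (A : Set Λ) (O : Matrix (Config Λ q) (Config Λ q) ℂ) : Prop :=
  ∃ M : Matrix (Config A q) (Config A q) ℂ, ∀ s s' : Config Λ q,
    O s s' = if ∀ g, g ∉ A → s g = s' g then M (fun a => s a) (fun a => s' a) else 0

/-- The interval of `n` consecutive sites starting at `o`. -/
def interval {L : ℕ} (o : ZMod L) (n : ℕ) : Set (ZMod L) :=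
  {g | ∃ j : ℕ, j < n ∧ g = o + j}

/-- Topological order of a Hamiltonian on the ring of `L` sites: `Π_L O Π_L ∝ Π_L` for each operator
`O` that is supported on an interval of size `L / 2`. -/
def CodeHamiltonian.TopologicallyOrdered {L : ℕ} [NeZero L] {q t : ℕ}
    (H : CodeHamiltonian (ZMod L) q t) : Prop :=
  ∀ (o : ZMod L) (O : Matrix (Config (ZMod L) q) (Config (ZMod L) q) ℂ),
    SupportedOn (interval o (L / 2)) O →
      ∃ c : ℂ, H.groundProj * Matrix.toEuclideanCLM (𝕜 := ℂ) O * H.groundProj = c • H.groundProj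

end PauliCode

end

noncomputable section

namespace PauliCode

open AddMonoidAlgebra (single)

/-! ### The symplectic form -/

section Form

variable {Λ : Type} [AddCommGroup Λ] {q : ℕ}

/-! Write `S` for the stabilizer module; commutation of the terms makes it isotropic for the form
`omega`, that is, `S ≤ perp S`.

Normal form. The ring `R` is a PID all of whose proper quotients by nonzero elements are finite, so
the torsion module `sat S / S` is killed by some `x^c - 1` (`exists_T_sub_one_smul_mem`).
Coarse-graining by `c` turns this into `x - 1`, which is irreducible. Choose a Lagrangian `K`
containing `S` (`exists_lagrangian`). In the Smith normal form of `S` inside `K` every elementary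
divisor is then `1` or `1 + x` up to units (`exists_basis_of_T_sub_one_smul`). A basis of `K`
extends to a symplectic basis of `P` (`exists_symplectic_of_basis`), so a symplectic map takes `K`
to the `σ_z`-part: divisors `1 + x` become Ising chains, divisors `1` become qubits with a term, and
the remaining basis vectors free qubits. No ancillas are needed.

No topological order. Topological order leaves no nontrivial logical operator on any half of the
ring. Cut a large ring into four arcs, two short and two long, such that no generator meets both
arcs of a nonadjacent pair. Each pair is then correctable (`Correctable.union`) and the two pairs
cover the ring, so by the cleaning lemma (`Correctable.perp_le`) there are no nontrivial logical
operators at all. The ground space is then one-dimensional because Pauli operators act irreducibly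
(`finrank_le_one`).

Degeneracy. If `perp S ≤ S`, the same holds for the normal form and forces `k = f = 0`
(`isingChains_eq_zero_of_perp_le`). Otherwise `H` is not exact, and a Nakayama argument
(`exists_redP_notMem`) finds arbitrarily large rings on which some element of `perp S` reduces to a
nontrivial logical operator, which cannot act on a one-dimensional ground space. -/

/-- The antipode of the group algebra. -/
def antipode (Λ : Type) [AddCommGroup Λ] :
    AddMonoidAlgebra (ZMod 2) Λ →+* AddMonoidAlgebra (ZMod 2) Λ :=
  AddMonoidAlgebra.mapDomainRingHom (ZMod 2) (negAddMonoidHom : Λ →+ Λ)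

@[simp] lemma antipode_single (g : Λ) (c : ZMod 2) : antipode Λ (single g c) = single (-g) c := by
  simp [antipode]

@[simp] lemma antipode_antipode (a : AddMonoidAlgebra (ZMod 2) Λ) :
    antipode Λ (antipode Λ a) = a := by
  induction a using AddMonoidAlgebra.induction_linear with
  | zero => simp
  | add f g hf hg => simp [hf, hg]
  | single g c => simp

lemma antipode_injective : Function.Injective (antipode Λ) :=
  Function.LeftInverse.injective antipode_antipode

/-- The symplectic form with values in the group algebra. -/
def omega (u v : PauliModule Λ q) : AddMonoidAlgebra (ZMod 2) Λ :=
  ∑ i, (antipode Λ (u (Sum.inl i)) * v (Sum.inr i) + antipode Λ (u (Sum.inr i)) * v (Sum.inl i))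

/-- The symplectic form with values in `𝔽₂`. -/
def bform (u v : PauliModule Λ q) : ZMod 2 := (omega u v).coeff 0

lemma omega_add_left (u u' v : PauliModule Λ q) : omega (u + u') v = omega u v + omega u' v := by
  simp only [omega, ← Finset.sum_add_distrib]
  refine Finset.sum_congr rfl fun i _ => ?_
  simp only [Pi.add_apply, map_add]; ring

lemma omega_add_right (u v v' : PauliModule Λ q) : omega u (v + v') = omega u v + omega u v' := by
  simp only [omega, ← Finset.sum_add_distrib]
  refine Finset.sum_congr rfl fun i _ => ?_
  simp only [Pi.add_apply]; ring

lemma omega_smul_left (r : AddMonoidAlgebra (ZMod 2) Λ) (u v : PauliModule Λ q) :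
    omega (r • u) v = antipode Λ r * omega u v := by
  simp only [omega, Finset.mul_sum]
  refine Finset.sum_congr rfl fun i _ => ?_
  simp only [Pi.smul_apply, smul_eq_mul, map_mul]; ring

lemma omega_smul_right (r : AddMonoidAlgebra (ZMod 2) Λ) (u v : PauliModule Λ q) :
    omega u (r • v) = r * omega u v := by
  simp only [omega, Finset.mul_sum]
  refine Finset.sum_congr rfl fun i _ => ?_
  simp only [Pi.smul_apply, smul_eq_mul]; ring

lemma omega_comm (u v : PauliModule Λ q) : omega v u = antipode Λ (omega u v) := by
  simp only [omega, map_sum]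
  refine Finset.sum_congr rfl fun i _ => ?_
  simp only [map_add, map_mul, antipode_antipode]; ring

/-- `omega u` as a linear map. -/
def omegaRight (u : PauliModule Λ q) :
    PauliModule Λ q →ₗ[AddMonoidAlgebra (ZMod 2) Λ] AddMonoidAlgebra (ZMod 2) Λ where
  toFun := omega u
  map_add' := omega_add_right u
  map_smul' r v := omega_smul_right r u v

@[simp] lemma omegaRight_apply (u v : PauliModule Λ q) : omegaRight u v = omega u v := rfl

@[simp] lemma omega_zero_right (u : PauliModule Λ q) : omega u 0 = 0 := (omegaRight u).map_zero

@[simp] lemma omega_zero_left (u : PauliModule Λ q) : omega 0 u = 0 := by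
  rw [omega_comm, omega_zero_right, map_zero]

lemma omega_sum_right {ι : Type*} (s : Finset ι) (u : PauliModule Λ q) (v : ι → PauliModule Λ q) :
    omega u (∑ i ∈ s, v i) = ∑ i ∈ s, omega u (v i) := map_sum (omegaRight u) v s

lemma omega_sum_left {ι : Type*} (s : Finset ι) (u : ι → PauliModule Λ q) (v : PauliModule Λ q) :
    omega (∑ i ∈ s, u i) v = ∑ i ∈ s, omega (u i) v := by
  rw [omega_comm, omega_sum_right, map_sum]
  exact Finset.sum_congr rfl fun i _ => (omega_comm _ _).symm

lemma omega_eq_zero_comm {u v : PauliModule Λ q} : omega u v = 0 ↔ omega v u = 0 := by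
  rw [omega_comm u v, map_eq_zero_iff _ antipode_injective]

/-- The submodule of the elements that are orthogonal to `S`. -/
def perp (S : Submodule (AddMonoidAlgebra (ZMod 2) Λ) (PauliModule Λ q)) :
    Submodule (AddMonoidAlgebra (ZMod 2) Λ) (PauliModule Λ q) where
  carrier := {v | ∀ u ∈ S, omega u v = 0}
  add_mem' h h' u hu := by rw [omega_add_right, h u hu, h' u hu, add_zero]
  zero_mem' u _ := omega_zero_right u
  smul_mem' r v h u hu := by rw [omega_smul_right, h u hu, mul_zero]

lemma omega_single (x : Fin q ⊕ Fin q) (r : AddMonoidAlgebra (ZMod 2) Λ) (u : PauliModule Λ q) :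
    omega u (Pi.single x r) = antipode Λ (u x.swap) * r := by
  classical
  rcases x with i | i <;> simp [omega, Pi.single_apply]

lemma coeff_antipode_mul (a b : AddMonoidAlgebra (ZMod 2) Λ) :
    (antipode Λ a * b).coeff 0 = a.coeff.sum fun g c => c * b.coeff g := by
  induction a using AddMonoidAlgebra.induction_linear with
  | zero => simp
  | add f g hf hg =>
    rw [map_add, add_mul, AddMonoidAlgebra.coeff_add, Finsupp.add_apply, hf, hg,
      AddMonoidAlgebra.coeff_add, Finsupp.sum_add_index'] <;> simp [add_mul]
  | single g c => simp [AddMonoidAlgebra.coeff_single_mul_apply]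

lemma bform_eq_parity (u v : PauliModule Λ q) :
    bform u v = parity (fun i => u (Sum.inl i)) (fun g i => (v (Sum.inr i)).coeff g) +
      parity (fun i => u (Sum.inr i)) (fun g i => (v (Sum.inl i)).coeff g) := by
  simp [bform, omega, coeff_antipode_mul, parity, Finset.sum_add_distrib]

/-- The `R`-valued form packs the commutation signs with all translates into one element, so for
translation-invariant modules the two notions of orthogonality agree. -/
lemma bform_translate (g : Λ) (u v : PauliModule Λ q) :
    bform (translate g u) v = (omega u v).coeff g := by
  simp [bform, translate, omega_smul_left, AddMonoidAlgebra.coeff_single_mul_apply]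

lemma omega_eq_zero_iff {u v : PauliModule Λ q} :
    omega u v = 0 ↔ ∀ g, bform (translate g u) v = 0 := by
  simp only [bform_translate]
  constructor
  · intro h g; simp [h]
  · intro h; ext g; exact h g

@[simp] lemma coeff_antipode (a : AddMonoidAlgebra (ZMod 2) Λ) (g : Λ) :
    (antipode Λ a).coeff g = a.coeff (-g) := by
  classical
  induction a using AddMonoidAlgebra.induction_linear with
  | zero => simp
  | add f g hf hg => simp [hf, hg]
  | single h c =>
    rw [antipode_single, AddMonoidAlgebra.coeff_single, AddMonoidAlgebra.coeff_single,
      Finsupp.single_apply, Finsupp.single_apply]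
    simp only [neg_eq_iff_eq_neg]

lemma coeff_zero_antipode (a : AddMonoidAlgebra (ZMod 2) Λ) :
    (antipode Λ a).coeff 0 = a.coeff 0 := by simp

lemma bform_comm (u v : PauliModule Λ q) : bform u v = bform v u := by
  rw [bform, bform, omega_comm v u, coeff_zero_antipode]

lemma bform_add_left (u u' v : PauliModule Λ q) : bform (u + u') v = bform u v + bform u' v := by
  simp [bform, omega_add_left]

lemma bform_add_right (u v v' : PauliModule Λ q) : bform u (v + v') = bform u v + bform u v' := by
  simp [bform, omega_add_right]

end Form

/-! ### Pauli operators -/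

section Pauli

variable {Λ : Type} {q : ℕ}

/-- The sign `(-1)^x`. -/
def sgn (x : ZMod 2) : ℂ := (-1) ^ x.val

@[simp] lemma sgn_zero : sgn 0 = 1 := by simp [sgn]

@[simp] lemma sgn_one : sgn 1 = -1 := by simp [sgn, ZMod.val_one]

lemma zmod_two_cases (x : ZMod 2) : x = 0 ∨ x = 1 := by
  revert x; decide

lemma sgn_add (x y : ZMod 2) : sgn (x + y) = sgn x * sgn y := by
  rcases zmod_two_cases x with rfl | rfl <;> rcases zmod_two_cases y with rfl | rfl <;>
    simp [CharTwo.add_self_eq_zero]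

@[simp] lemma sgn_mul_self (x : ZMod 2) : sgn x * sgn x = 1 := by
  rw [← sgn_add, CharTwo.add_self_eq_zero, sgn_zero]

lemma sgn_ne_zero (x : ZMod 2) : sgn x ≠ 0 := by
  rcases zmod_two_cases x with rfl | rfl <;> simp

@[simp] lemma star_sgn (x : ZMod 2) : star (sgn x) = sgn x := by
  rcases zmod_two_cases x with rfl | rfl <;> simp

/-- The configuration of the coefficients. -/
def config (a : Fin q → AddMonoidAlgebra (ZMod 2) Λ) : Config Λ q := fun g i => (a i).coeff g

lemma config_add (a a' : Fin q → AddMonoidAlgebra (ZMod 2) Λ) :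
    config (a + a') = config a + config a' := by
  ext; simp [config]

lemma parity_add_left (b b' : Fin q → AddMonoidAlgebra (ZMod 2) Λ) (s : Config Λ q) :
    parity (b + b') s = parity b s + parity b' s := by
  simp only [parity, ← Finset.sum_add_distrib]
  refine Finset.sum_congr rfl fun i _ => ?_
  rw [Pi.add_apply, AddMonoidAlgebra.coeff_add, Finsupp.sum_add_index'] <;> simp [add_mul]

lemma parity_add_right (b : Fin q → AddMonoidAlgebra (ZMod 2) Λ) (s s' : Config Λ q) :
    parity b (s + s') = parity b s + parity b s' := by
  simp [parity, mul_add, Finsupp.sum, Finset.sum_add_distrib]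

/-- The `σ_x`-part. -/
def xPart (v : PauliModule Λ q) : Fin q → AddMonoidAlgebra (ZMod 2) Λ := fun i => v (Sum.inl i)

/-- The `σ_z`-part. -/
def zPart (v : PauliModule Λ q) : Fin q → AddMonoidAlgebra (ZMod 2) Λ := fun i => v (Sum.inr i)

lemma config_sub_eq_add (s t : Config Λ q) : s - t = s + t := by
  ext g i; simp [CharTwo.sub_eq_add]

lemma config_add_self (s : Config Λ q) : s + s = 0 := by
  ext g i; simp [CharTwo.add_self_eq_zero]

lemma pauliOp_apply (v : PauliModule Λ q) (ψ : WaveFun Λ q) (s : Config Λ q) :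
    pauliOp v ψ s =
      sgn (parity (zPart v) (s + config (xPart v))) * ψ (s + config (xPart v)) := by
  have : (fun g i => s g i - (v (Sum.inl i)).coeff g) = s + config (xPart v) := by
    ext g i; simp [config, xPart, CharTwo.sub_eq_add]
  simp only [pauliOp, pauliX, pauliZ, Module.End.mul_apply, LinearMap.coe_mk, AddHom.coe_mk, this]
  rfl

lemma pauliOp_mul (u v : PauliModule Λ q) :
    pauliOp u * pauliOp v = sgn (parity (zPart u) (config (xPart v))) • pauliOp (u + v) := by
  ext1 ψ
  ext s
  have h1 : xPart (u + v) = xPart u + xPart v := rfl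
  have h2 : zPart (u + v) = zPart u + zPart v := rfl
  simp only [Module.End.mul_apply, LinearMap.smul_apply, Pi.smul_apply, smul_eq_mul, pauliOp_apply,
    h1, h2, config_add, ← add_assoc, parity_add_left, parity_add_right, sgn_add]
  linear_combination (-sgn (parity (zPart u) s) * sgn (parity (zPart u) (config (xPart u))) *
    sgn (parity (zPart v) s) * sgn (parity (zPart v) (config (xPart u))) *
    sgn (parity (zPart v) (config (xPart v))) * ψ (s + config (xPart u) + config (xPart v))) *
      sgn_mul_self (parity (zPart u) (config (xPart v)))

variable [AddCommGroup Λ]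

lemma parity_config_comm (a b : Fin q → AddMonoidAlgebra (ZMod 2) Λ) :
    parity a (config b) = parity b (config a) := by
  simp only [parity, config, ← coeff_antipode_mul]
  refine Finset.sum_congr rfl fun i _ => ?_
  rw [← coeff_zero_antipode, map_mul, antipode_antipode, mul_comm]

lemma bform_eq (u v : PauliModule Λ q) :
    bform u v = parity (zPart u) (config (xPart v)) + parity (zPart v) (config (xPart u)) := by
  rw [bform_eq_parity, add_comm]
  exact congrArg₂ _ rfl (parity_config_comm (xPart u) (zPart v))

lemma pauliOp_comm (u v : PauliModule Λ q) :
    pauliOp u * pauliOp v = sgn (bform u v) • (pauliOp v * pauliOp u) := by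
  rw [pauliOp_mul, pauliOp_mul, bform_eq, sgn_add, smul_smul, add_comm v u, mul_assoc, sgn_mul_self,
    mul_one]

lemma pauliOp_anticomm {u v : PauliModule Λ q} (h : bform u v ≠ 0) :
    pauliOp u * pauliOp v = -(pauliOp v * pauliOp u) := by
  rw [pauliOp_comm, (zmod_two_cases _).resolve_left h, sgn_one]
  ext1 ψ
  exact neg_one_smul ℂ _

@[simp] lemma pauliOp_zero : pauliOp (0 : PauliModule Λ q) = 1 := by
  ext1 ψ
  ext s
  have h1 : config (xPart (0 : PauliModule Λ q)) = 0 := by ext; simp [config, xPart]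
  have h2 : parity (zPart (0 : PauliModule Λ q)) (s + 0) = 0 := by simp [parity, zPart]
  rw [pauliOp_apply, h1, h2]
  simp

lemma pauli_add_self (v : PauliModule Λ q) : v + v = 0 := by
  ext; simp [CharTwo.add_self_eq_zero]

lemma pauliOp_mul_self (v : PauliModule Λ q) :
    pauliOp v * pauliOp v = sgn (parity (zPart v) (config (xPart v))) • 1 := by
  rw [pauliOp_mul, pauli_add_self, pauliOp_zero]

lemma pauliOp_apply_eq_zero {v : PauliModule Λ q} {ψ : WaveFun Λ q} (h : pauliOp v ψ = 0) :
    ψ = 0 := by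
  have := congrArg (fun f => f ψ) (pauliOp_mul_self v)
  simpa [h, sgn_ne_zero] using this.symm

end Pauli

/-! ### Stabilizers and the ground space -/

section Stabilizer

variable {Λ : Type} [AddCommGroup Λ] {q t : ℕ}

omit [AddCommGroup Λ] in
lemma one_ne_zero_end : (1 : Module.End ℂ (WaveFun Λ q)) ≠ 0 := by
  intro h
  have := congrFun (congrArg (fun f => f (fun _ => (1 : ℂ))) h) 0
  simp at this

lemma pauliOp_mul_ne_zero (u v : PauliModule Λ q) : pauliOp u * pauliOp v ≠ 0 := by
  intro h
  refine one_ne_zero_end (Λ := Λ) (q := q) ?_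
  ext1 ψ
  have := congrArg (fun f => f ψ) h
  simpa using pauliOp_apply_eq_zero (pauliOp_apply_eq_zero this)

lemma CodeHamiltonian.phase_ne_zero (H : CodeHamiltonian Λ q t) (i : Fin t) (g : Λ) :
    H.phase i g ≠ 0 := by
  intro h
  have h1 := H.term_sq i g
  rw [H.term_eq, h, zero_smul, zero_mul] at h1
  exact one_ne_zero_end h1.symm

/-- Two Pauli operators commute or anticommute; if both held, their product would vanish, but Pauli
operators are invertible. -/
lemma CodeHamiltonian.bform_gen (H : CodeHamiltonian Λ q t) (i j : Fin t) (g h : Λ) :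
    bform (translate g (H.gen.col i)) (translate h (H.gen.col j)) = 0 := by
  have h1 := H.commuting i g j h
  rw [Commute, SemiconjBy, H.term_eq, H.term_eq, smul_mul_smul_comm, smul_mul_smul_comm,
    mul_comm (H.phase j h)] at h1
  have h2 := smul_right_injective _ (mul_ne_zero (H.phase_ne_zero i g) (H.phase_ne_zero j h)) h1
  by_contra h3
  refine pauliOp_mul_ne_zero (translate h (H.gen.col j)) (translate g (H.gen.col i)) ?_
  have h4 := h2.symm.trans (pauliOp_anticomm h3)
  ext1 ψ
  exact self_eq_neg.mp (congrArg (fun f => f ψ) h4)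

lemma CodeHamiltonian.mem_perp_iff_omega (H : CodeHamiltonian Λ q t) {v : PauliModule Λ q} :
    v ∈ perp H.stabilizerModule ↔ ∀ i, omega (H.gen.col i) v = 0 := by
  constructor
  · intro h i
    exact h _ (Submodule.subset_span ⟨i, rfl⟩)
  · intro h u hu
    induction hu using Submodule.span_induction with
    | mem x hx => obtain ⟨i, rfl⟩ := hx; exact h i
    | zero => simp
    | add x y _ _ hx hy => rw [omega_add_left, hx, hy, add_zero]
    | smul r x _ hx => rw [omega_smul_left, hx, mul_zero]

lemma CodeHamiltonian.mem_perp_iff (H : CodeHamiltonian Λ q t) {v : PauliModule Λ q} :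
    v ∈ perp H.stabilizerModule ↔ ∀ i g, bform (translate g (H.gen.col i)) v = 0 := by
  simp only [H.mem_perp_iff_omega, omega_eq_zero_iff]

@[simp] lemma translate_zero (v : PauliModule Λ q) : translate 0 v = v := one_smul _ v

lemma CodeHamiltonian.stabilizerModule_le_perp (H : CodeHamiltonian Λ q t) :
    H.stabilizerModule ≤ perp H.stabilizerModule := by
  refine Submodule.span_le.mpr ?_
  rintro _ ⟨j, rfl⟩
  refine H.mem_perp_iff.mpr fun i g => ?_
  simpa using H.bform_gen i j g 0

lemma CodeHamiltonian.mem_groundSpace {H : CodeHamiltonian Λ q t} {ψ : WaveFun Λ q} :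
    ψ ∈ H.groundSpace ↔ ∀ i g, H.term i g ψ = ψ := by
  simp [CodeHamiltonian.groundSpace]

lemma CodeHamiltonian.term_mul_pauliOp (H : CodeHamiltonian Λ q t) (i : Fin t) (g : Λ)
    (v : PauliModule Λ q) :
    H.term i g * pauliOp v =
      sgn (bform (translate g (H.gen.col i)) v) • (pauliOp v * H.term i g) := by
  rw [H.term_eq, smul_mul_assoc, pauliOp_comm, mul_smul_comm, smul_comm]

lemma CodeHamiltonian.pauliOp_mem_groundSpace {H : CodeHamiltonian Λ q t} {v : PauliModule Λ q}
    (hv : v ∈ perp H.stabilizerModule) {ψ : WaveFun Λ q} (hψ : ψ ∈ H.groundSpace) :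
    pauliOp v ψ ∈ H.groundSpace := by
  rw [mem_groundSpace] at hψ ⊢
  intro i g
  have := congrArg (fun f => f ψ) (H.term_mul_pauliOp i g v)
  simpa [H.mem_perp_iff.mp hv i g, hψ i g] using this

lemma CodeHamiltonian.groundSpace_ne_bot (H : CodeHamiltonian Λ q t) : H.groundSpace ≠ ⊥ := by
  obtain ⟨ψ, h0, h⟩ := H.frustrationFree
  exact (Submodule.ne_bot_iff _).mpr ⟨ψ, mem_groundSpace.mpr h, h0⟩

/-- If the logical operator `v` anticommutes with a logical operator, then it does not act as a
scalar on the ground space. -/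
lemma CodeHamiltonian.not_scalar_of_bform {H : CodeHamiltonian Λ q t} {v w : PauliModule Λ q}
    (hw : w ∈ perp H.stabilizerModule) (hvw : bform v w ≠ 0) (c : ℂ) :
    ¬ ∀ ψ ∈ H.groundSpace, pauliOp v ψ = c • ψ := by
  intro h
  obtain ⟨ψ, hψ, h0⟩ := (Submodule.ne_bot_iff _).mp H.groundSpace_ne_bot
  have h1 := h _ (pauliOp_mem_groundSpace hw hψ)
  have h2 := congrArg (fun f => f ψ) (pauliOp_anticomm hvw)
  simp only [Module.End.mul_apply, h1, h ψ hψ, map_smul, LinearMap.neg_apply] at h2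
  -- On `pauliOp w ψ`, again a ground state, `v` has eigenvalue `c` by assumption and `-c` by
  -- anticommutation; injectivity of Pauli operators excludes both ways out.
  have h3 : c • pauliOp w ψ = 0 := self_eq_neg.mp h2
  rcases smul_eq_zero.mp h3 with hc | hc
  · have := h ψ hψ
    rw [hc, zero_smul] at this
    exact h0 (pauliOp_apply_eq_zero this)
  · exact h0 (pauliOp_apply_eq_zero hc)

/-- Stabilizers act as scalars on the ground space. -/
lemma CodeHamiltonian.scalar_of_mem {H : CodeHamiltonian Λ q t} {v : PauliModule Λ q}
    (hv : v ∈ H.stabilizerModule) : ∃ c : ℂ, ∀ ψ ∈ H.groundSpace, pauliOp v ψ = c • ψ := by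
  have hzero : ∃ c : ℂ, ∀ ψ ∈ H.groundSpace, pauliOp (0 : PauliModule Λ q) ψ = c • ψ :=
    ⟨1, by simp⟩
  have hadd : ∀ u v : PauliModule Λ q, (∃ c : ℂ, ∀ ψ ∈ H.groundSpace, pauliOp u ψ = c • ψ) →
      (∃ c : ℂ, ∀ ψ ∈ H.groundSpace, pauliOp v ψ = c • ψ) →
      ∃ c : ℂ, ∀ ψ ∈ H.groundSpace, pauliOp (u + v) ψ = c • ψ := by
    rintro u v ⟨c, hc⟩ ⟨d, hd⟩
    refine ⟨(sgn (parity (zPart u) (config (xPart v))))⁻¹ * (d * c), fun ψ hψ => ?_⟩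
    have := congrArg (fun f => f ψ) (pauliOp_mul u v)
    simp only [Module.End.mul_apply, hd ψ hψ, map_smul, hc ψ hψ, LinearMap.smul_apply] at this
    rw [mul_smul, mul_smul, this, inv_smul_smul₀ (sgn_ne_zero _)]
  -- Span induction only reaches the generators themselves; quantifying over the multiples `r • v`
  -- brings in their translates, which are the actual terms.
  suffices h : ∀ r : AddMonoidAlgebra (ZMod 2) Λ,
      ∃ c : ℂ, ∀ ψ ∈ H.groundSpace, pauliOp (r • v) ψ = c • ψ by simpa using h 1
  induction hv using Submodule.span_induction with
  | zero => simpa using hzero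
  | add x y _ _ hx hy => intro r; rw [smul_add]; exact hadd _ _ (hx r) (hy r)
  | smul a x _ hx => intro r; rw [smul_smul]; exact hx _
  | mem x hx =>
    obtain ⟨i, rfl⟩ := hx
    intro r
    induction r using AddMonoidAlgebra.induction_linear with
    | zero => simpa using hzero
    | add f g hf hg => rw [add_smul]; exact hadd _ _ hf hg
    | single g c =>
      rcases zmod_two_cases c with rfl | rfl
      · simpa using hzero
      · refine ⟨(H.phase i g)⁻¹, fun ψ hψ => ?_⟩
        have h1 := mem_groundSpace.mp hψ i g
        rw [H.term_eq, LinearMap.smul_apply] at h1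
        rw [eq_inv_smul_iff₀ (H.phase_ne_zero i g)]
        exact h1

end Stabilizer

/-! ### Finite systems -/

section Finite

variable {Λ : Type} [AddCommGroup Λ] {q t : ℕ}

/-- `bform w` as a linear map. -/
def bformRight (w : PauliModule Λ q) : PauliModule Λ q →ₗ[ZMod 2] ZMod 2 :=
  (AddMonoidHom.mk' (bform w) (bform_add_right w)).toZModLinearMap 2

lemma bformRight_apply (w v : PauliModule Λ q) : bformRight w v = bform w v := rfl

/-- Nondegeneracy of the form: the values of `f` on single-qubit operators, with the `σ_x`- and
`σ_z`-parts swapped, are the coefficients of `w`. Finiteness of `Λ` makes `w` finitely supported. -/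
lemma exists_eq_bformRight [Finite Λ] (f : PauliModule Λ q →ₗ[ZMod 2] ZMod 2) :
    ∃ w, f = bformRight w := by
  classical
  refine ⟨fun x => AddMonoidAlgebra.ofCoeff (Finsupp.equivFunOnFinite.symm
    fun g => f (Pi.single x.swap (single g 1))), ?_⟩
  refine LinearMap.toAddMonoidHom_injective ?_
  refine AddMonoidHom.functions_ext' _ _ _ fun x => ?_
  refine AddMonoidAlgebra.addMonoidHom_ext fun g c => ?_
  have h : (Pi.single x (single g c) : PauliModule Λ q) = c • Pi.single x (single g 1) := by
    rw [← Pi.single_smul']; simp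
  simp only [AddMonoidHom.comp_apply, AddMonoidHom.single_apply, LinearMap.toAddMonoidHom_coe]
  rw [h, map_smul, map_smul, bformRight_apply, bform, omega_single]
  simp [AddMonoidAlgebra.coeff_mul_single_apply]

lemma exists_bform_ne_zero [Finite Λ] {N : Submodule (ZMod 2) (PauliModule Λ q)}
    {v : PauliModule Λ q} (hv : v ∉ N) : ∃ w, (∀ u ∈ N, bform w u = 0) ∧ bform w v ≠ 0 := by
  obtain ⟨f, hf, hN⟩ := Submodule.exists_le_ker_of_notMem hv
  obtain ⟨w, rfl⟩ := exists_eq_bformRight f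
  exact ⟨w, fun u hu => hN hu, hf⟩

/-- The double complement theorem for a finite system: every nontrivial logical operator
anticommutes with some logical operator. On the infinite chain it fails, since the double complement
is the saturation. -/
lemma exists_mem_perp_bform_ne_zero [Finite Λ]
    {S : Submodule (AddMonoidAlgebra (ZMod 2) Λ) (PauliModule Λ q)}
    {v : PauliModule Λ q} (hv : v ∉ S) : ∃ w ∈ perp S, bform w v ≠ 0 := by
  obtain ⟨w, hw, hv⟩ := exists_bform_ne_zero (N := S.restrictScalars (ZMod 2)) hv
  refine ⟨w, fun u hu => omega_eq_zero_iff.mpr fun g => ?_, hv⟩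
  rw [bform_comm]
  exact hw _ (S.smul_mem _ hu)

lemma CodeHamiltonian.one_lt_finrank [Finite Λ] {H : CodeHamiltonian Λ q t}
    {v : PauliModule Λ q} (hv : v ∈ perp H.stabilizerModule) (hv' : v ∉ H.stabilizerModule) :
    1 < Module.finrank ℂ H.groundSpace := by
  obtain ⟨w, hw, hwv⟩ := exists_mem_perp_bform_ne_zero hv'
  rw [bform_comm] at hwv
  by_contra h
  obtain ⟨ψ, hψ⟩ := finrank_le_one_iff.mp (not_lt.mp h)
  obtain ⟨c, hc⟩ := hψ ⟨_, pauliOp_mem_groundSpace hv ψ.2⟩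
  refine not_scalar_of_bform hw hwv c fun φ hφ => ?_
  obtain ⟨d, hd⟩ := hψ ⟨φ, hφ⟩
  have h1 : φ = d • (ψ : WaveFun Λ q) := by simpa using (congrArg Subtype.val hd).symm
  have h2 : pauliOp v (ψ : WaveFun Λ q) = c • (ψ : WaveFun Λ q) := by
    simpa using (congrArg Subtype.val hc).symm
  rw [h1, map_smul, h2, smul_comm]

omit [AddCommGroup Λ] in
-- Orthogonality of characters: flipping `b` at a position where `s` is `1` reverses every sign.
lemma sum_sgn_parity_eq_zero [Fintype Λ] [DecidableEq Λ] {s : Config Λ q} (hs : s ≠ 0) :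
    ∑ b : Config Λ q, sgn (∑ g, ∑ i, b g i * s g i) = 0 := by
  obtain ⟨g, hg⟩ := Function.ne_iff.mp hs
  obtain ⟨i, hi⟩ := Function.ne_iff.mp hg
  have h := Equiv.sum_comp (Equiv.addRight (Pi.single g (Pi.single i 1) : Config Λ q))
    fun b : Config Λ q => sgn (∑ g, ∑ i, b g i * s g i)
  have h2 : ∑ x, ∑ j, (Pi.single g (Pi.single i 1) : Config Λ q) x j * s x j = 1 := by
    rw [Finset.sum_eq_single g, Finset.sum_eq_single i]
    · simpa using (zmod_two_cases _).resolve_left hi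
    · intro j _ hj; simp [hj]
    · simp
    · intro x _ hx; simp [hx]
    · simp
  simp only [Equiv.coe_addRight, Pi.add_apply, add_mul, Finset.sum_add_distrib, h2, sgn_add,
    sgn_one, mul_neg, mul_one, Finset.sum_neg_distrib] at h
  exact self_eq_neg.mp h.symm

omit [AddCommGroup Λ] in
/-- Fourier inversion. -/
lemma eq_zero_of_sum_sgn [Fintype Λ] [DecidableEq Λ] (F : Config Λ q → ℂ)
    (h : ∀ b : Config Λ q, ∑ s, sgn (∑ g, ∑ i, b g i * s g i) * F s = 0) : F = 0 := by
  ext s₀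
  have h1 : ∑ b : Config Λ q, sgn (∑ g, ∑ i, b g i * s₀ g i) *
      ∑ s, sgn (∑ g, ∑ i, b g i * s g i) * F s = 0 := by simp [h]
  simp only [Finset.mul_sum, ← mul_assoc, ← sgn_add, ← Finset.sum_add_distrib, ← mul_add] at h1
  rw [Finset.sum_comm] at h1
  simp only [← Finset.sum_mul] at h1
  rw [Finset.sum_eq_single s₀] at h1
  · simpa [CharTwo.add_self_eq_zero] using h1
  · intro s _ hs
    have : s₀ + s ≠ 0 := by
      intro h0
      apply hs
      rw [← sub_eq_zero, config_sub_eq_add, add_comm, h0]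
    have h2 := sum_sgn_parity_eq_zero this
    simp only [Pi.add_apply] at h2
    rw [h2, zero_mul]
  · simp

omit [AddCommGroup Λ] in
lemma parity_eq_sum [Fintype Λ] (b : Fin q → AddMonoidAlgebra (ZMod 2) Λ) (s : Config Λ q) :
    parity b s = ∑ g, ∑ i, (b i).coeff g * s g i := by
  rw [Finset.sum_comm]
  refine Finset.sum_congr rfl fun i _ => ?_
  exact Finsupp.sum_fintype _ _ (by simp)

omit [AddCommGroup Λ] in
/-- Pauli operators act irreducibly. -/
lemma eq_zero_or_eq_zero_of_sum_pauliOp [Fintype Λ] [DecidableEq Λ] {φ ψ : WaveFun Λ q}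
    (h : ∀ v : PauliModule Λ q, ∑ s, star (φ s) * pauliOp v ψ s = 0) : φ = 0 ∨ ψ = 0 := by
  by_contra! hne
  obtain ⟨s₁, h₁⟩ := Function.ne_iff.mp hne.1
  obtain ⟨s₀, h₀⟩ := Function.ne_iff.mp hne.2
  set a : Config Λ q := s₁ - s₀ with ha
  -- With the `σ_x`-part fixed to `a` and the `σ_z`-part `b` varying, the matrix elements are the
  -- Fourier coefficients of this function, and `a` is chosen so that it does not vanish at `s₀`.
  have key := eq_zero_of_sum_sgn (fun s => star (φ (s + a)) * ψ s) fun b => by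
    have h2 := h (Sum.elim
      (fun i => AddMonoidAlgebra.ofCoeff (Finsupp.equivFunOnFinite.symm fun g => a g i))
      (fun i => AddMonoidAlgebra.ofCoeff (Finsupp.equivFunOnFinite.symm fun g => b g i)))
    rw [← Equiv.sum_comp (Equiv.addRight a)] at h2
    rw [← h2]
    refine Finset.sum_congr rfl fun s _ => ?_
    rw [pauliOp_apply, parity_eq_sum]
    have h3 : config (xPart (Sum.elim
      (fun i => AddMonoidAlgebra.ofCoeff (Finsupp.equivFunOnFinite.symm fun g => a g i))
      (fun i => AddMonoidAlgebra.ofCoeff (Finsupp.equivFunOnFinite.symm fun g => b g i)))) = a := by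
      ext g i; simp [config, xPart]
    rw [h3, Equiv.coe_addRight, add_assoc, config_add_self, add_zero]
    simp only [zPart, Sum.elim_inr, Finsupp.equivFunOnFinite_symm_apply_apply]
    ring
  have := congrFun key s₀
  rw [ha] at this
  simp only [add_sub_cancel, Pi.zero_apply, mul_eq_zero, star_eq_zero] at this
  exact this.elim h₁ h₀

omit [AddCommGroup Λ] in
lemma sum_star_pauliOp [Fintype Λ] [DecidableEq Λ] (v : PauliModule Λ q) (φ ψ : WaveFun Λ q) :
    ∑ s, star (pauliOp v φ s) * pauliOp v ψ s = ∑ s, star (φ s) * ψ s := by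
  rw [← Equiv.sum_comp (Equiv.addRight (config (xPart v))) fun s => star (φ s) * ψ s]
  refine Finset.sum_congr rfl fun s _ => ?_
  rw [pauliOp_apply, pauliOp_apply, star_mul', star_sgn, Equiv.coe_addRight]
  linear_combination star (φ (s + config (xPart v))) * ψ (s + config (xPart v)) *
    sgn_mul_self (parity (zPart v) (s + config (xPart v)))

/-- The images of the ground space under operators that create an excitation are orthogonal to
the ground space. -/
lemma CodeHamiltonian.sum_star_eq_zero_of_notMem_perp [Fintype Λ] [DecidableEq Λ]
    {H : CodeHamiltonian Λ q t} {v : PauliModule Λ q} (hv : v ∉ perp H.stabilizerModule)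
    {φ ψ : WaveFun Λ q} (hφ : φ ∈ H.groundSpace) (hψ : ψ ∈ H.groundSpace) :
    ∑ s, star (φ s) * pauliOp v ψ s = 0 := by
  rw [H.mem_perp_iff] at hv
  push Not at hv
  obtain ⟨i, g, hig⟩ := hv
  have h1 := congrArg (fun f => f ψ) (H.term_mul_pauliOp i g v)
  rw [(zmod_two_cases _).resolve_left hig] at h1
  simp only [Module.End.mul_apply, LinearMap.smul_apply, mem_groundSpace.mp hψ i g, sgn_one,
    neg_smul, one_smul] at h1
  have h2 := mem_groundSpace.mp hφ i g
  rw [H.term_eq, LinearMap.smul_apply] at h1 h2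
  set p := H.phase i g
  have h3 := sum_star_pauliOp (translate g (H.gen.col i)) φ (pauliOp v ψ)
  have h4 : star p * p * ∑ s, star (φ s) * pauliOp v ψ s = - ∑ s, star (φ s) * pauliOp v ψ s := by
    rw [← h3, Finset.mul_sum, h3, ← Finset.sum_neg_distrib]
    refine Finset.sum_congr rfl fun s _ => ?_
    have e1 := congrFun h1 s
    have e2 := congrFun h2 s
    simp only [Pi.smul_apply, smul_eq_mul, Pi.neg_apply] at e1 e2
    have e3 : star p * star (pauliOp (translate g (H.gen.col i)) φ s) = star (φ s) := by
      rw [← star_mul', e2]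
    rw [mul_mul_mul_comm, e3, e1, mul_neg]
  -- Positivity of `|p|² + 1` suffices, so it need not be shown that the phase has modulus one.
  have h5 : (star p * p + 1) * ∑ s, star (φ s) * pauliOp v ψ s = 0 := by
    rw [add_mul, h4]; ring
  refine (mul_eq_zero.mp h5).resolve_left ?_
  have h6 : star p * p = ((Complex.normSq p : ℝ) : ℂ) := Complex.normSq_eq_conj_mul_self.symm
  rw [h6]
  have := Complex.normSq_nonneg p
  norm_cast
  positivity

open scoped ComplexOrder in
lemma CodeHamiltonian.finrank_le_one [Finite Λ] {H : CodeHamiltonian Λ q t}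
    (h : perp H.stabilizerModule ≤ H.stabilizerModule) :
    Module.finrank ℂ H.groundSpace ≤ 1 := by
  classical
  have := Fintype.ofFinite Λ
  obtain ⟨ψ, hψ, h0⟩ := (Submodule.ne_bot_iff _).mp H.groundSpace_ne_bot
  have hnorm : ∑ s, star (ψ s) * ψ s ≠ 0 := by
    intro hs
    apply h0
    exact dotProduct_star_self_eq_zero.mp hs
  refine finrank_le_one_iff.mpr ⟨⟨ψ, hψ⟩, fun w => ?_⟩
  set c : ℂ := (∑ s, star (w.1 s) * ψ s) / ∑ s, star (ψ s) * ψ s with hc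
  have horth : ∑ s, star ((w.1 - star c • ψ) s) * ψ s = 0 := by
    simp only [Pi.sub_apply, Pi.smul_apply, smul_eq_mul, star_sub, star_mul', star_star, sub_mul,
      Finset.sum_sub_distrib, mul_assoc, ← Finset.mul_sum]
    rw [hc, div_mul_cancel₀ _ hnorm, sub_self]
  have hmem : w.1 - star c • ψ ∈ H.groundSpace := sub_mem w.2 (H.groundSpace.smul_mem _ hψ)
  refine ⟨star c, Subtype.ext ?_⟩
  -- The component of `w` orthogonal to `ψ` is orthogonal to every `pauliOp v ψ`: a logical `v` is a
  -- stabilizer and acts as a scalar, and any other `v` leads out of the ground space.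
  have key := eq_zero_or_eq_zero_of_sum_pauliOp (φ := w.1 - star c • ψ) (ψ := ψ) fun v => by
    by_cases hv : v ∈ perp H.stabilizerModule
    · obtain ⟨d, hd⟩ := scalar_of_mem (h hv)
      rw [hd ψ hψ]
      have : ∑ s, star ((w.1 - star c • ψ) s) * (d • ψ) s =
          d * ∑ s, star ((w.1 - star c • ψ) s) * ψ s := by
        rw [Finset.mul_sum]
        exact Finset.sum_congr rfl fun s _ => mul_left_comm _ _ _
      rw [this, horth, mul_zero]
    · exact sum_star_eq_zero_of_notMem_perp hv hmem hψ
  exact (sub_eq_zero.mp (key.resolve_right h0)).symm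

end Finite

/-! ### Correctable regions of the ring -/

section Cleaning

variable {L q t : ℕ} [NeZero L]

/-- `v` is supported on the set `A` of sites. -/
def Supp {Λ : Type} (A : Set Λ) (v : PauliModule Λ q) : Prop :=
  ∀ x, ∀ g ∉ A, (v x).coeff g = 0

open Classical in
/-- The restriction of `v` to the set `A` of sites. -/
def restrict {Λ : Type} (A : Set Λ) (v : PauliModule Λ q) : PauliModule Λ q :=
  fun x => AddMonoidAlgebra.ofCoeff ((v x).coeff.filter (· ∈ A))

lemma restrict_add_compl {Λ : Type} (A : Set Λ) (v : PauliModule Λ q) :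
    restrict A v + restrict Aᶜ v = v := by
  classical
  ext x g
  by_cases hg : g ∈ A <;> simp [restrict]

lemma supp_restrict {Λ : Type} (A : Set Λ) (v : PauliModule Λ q) : Supp A (restrict A v) := by
  intro x g hg
  simp [restrict, hg]

lemma Supp.mono {Λ : Type} {A B : Set Λ} (h : A ⊆ B) {v : PauliModule Λ q} (hv : Supp A v) :
    Supp B v := fun x g hg => hv x g fun hA => hg (h hA)

lemma parity_eq_zero {Λ : Type} (b : Fin q → AddMonoidAlgebra (ZMod 2) Λ) (s : Config Λ q)
    (h : ∀ i g, (b i).coeff g = 0 ∨ s g i = 0) : parity b s = 0 := by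
  refine Finset.sum_eq_zero fun i _ => Finset.sum_eq_zero fun g _ => ?_
  rcases h i g with h | h <;> simp [h]

lemma bform_eq_zero_of_disjoint {Λ : Type} [AddCommGroup Λ] {A B : Set Λ} (h : Disjoint A B)
    {u v : PauliModule Λ q} (hu : Supp A u) (hv : Supp B v) : bform u v = 0 := by
  rw [bform_eq_parity, parity_eq_zero, parity_eq_zero, add_zero]
  all_goals
    intro i g
    by_cases hg : g ∈ A
    · exact Or.inr (hv _ g (Set.disjoint_left.mp h hg))
    · exact Or.inl (hu _ g hg)

/-- The set `A` of sites supports no nontrivial logical operator. -/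
def CodeHamiltonian.Correctable {Λ : Type} [AddCommGroup Λ] (H : CodeHamiltonian Λ q t)
    (A : Set Λ) : Prop :=
  ∀ v ∈ perp H.stabilizerModule, Supp A v → v ∈ H.stabilizerModule

/-- The cleaning lemma: if a region and its complement support no nontrivial logical operators,
then there are none. -/
lemma CodeHamiltonian.Correctable.perp_le {Λ : Type} [AddCommGroup Λ] [Finite Λ]
    {H : CodeHamiltonian Λ q t} {A : Set Λ} (h : H.Correctable A) (h' : H.Correctable Aᶜ) :
    perp H.stabilizerModule ≤ H.stabilizerModule := by
  intro v hv
  let N : Submodule (ZMod 2) (PauliModule Λ q) :=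
    { carrier := {w | Supp Aᶜ w}
      add_mem' := fun ha hb x g hg => by simp [ha x g hg, hb x g hg]
      zero_mem' := fun x g _ => by simp
      smul_mem' := fun c w hw x g hg => by simp [hw x g hg] }
  -- Either a stabilizer moves `v` off `A`, or some `w` orthogonal to all stabilizers and to all
  -- operators on the complement detects `v`. Such a `w` is a logical operator living on `A`, hence
  -- a stabilizer, hence orthogonal to `v`.
  by_cases hvN : v ∈ H.stabilizerModule.restrictScalars (ZMod 2) ⊔ N
  · obtain ⟨s, hs, w, hw, rfl⟩ := Submodule.mem_sup.mp hvN
    refine add_mem hs (h' w ?_ hw)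
    simpa using sub_mem hv (H.stabilizerModule_le_perp hs)
  · obtain ⟨w, hw, hwv⟩ := exists_bform_ne_zero hvN
    have hw1 : w ∈ perp H.stabilizerModule := by
      refine fun u hu => omega_eq_zero_iff.mpr fun g => ?_
      rw [bform_comm]
      exact hw _ (Submodule.mem_sup_left (H.stabilizerModule.smul_mem _ hu))
    have hw2 : Supp A w := by
      intro x g hg
      have h1 := hw (Pi.single x.swap (single g 1)) (Submodule.mem_sup_right (by
        intro y k hk
        rcases eq_or_ne y x.swap with rfl | hy
        · have : g ≠ k := by rintro rfl; exact hk hg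
          simp [this]
        · simp [hy]))
      rw [bform, omega_single] at h1
      simpa [AddMonoidAlgebra.coeff_mul_single_apply] using h1
    refine absurd ?_ hwv
    have := omega_eq_zero_iff.mp (hv w (h w hw1 hw2)) 0
    simpa using this

/-- The union of two correctable regions that no generator connects is correctable. -/
lemma CodeHamiltonian.Correctable.union {Λ : Type} [AddCommGroup Λ]
    {H : CodeHamiltonian Λ q t} {A B : Set Λ} (hA : H.Correctable A) (hB : H.Correctable B)
    (h : ∀ i g, (Supp Aᶜ (translate g (H.gen.col i))) ∨ Supp Bᶜ (translate g (H.gen.col i))) :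
    H.Correctable (A ∪ B) := by
  intro v hv hsupp
  have hsuppB : Supp B (restrict Aᶜ v) := by
    classical
    intro x g hg
    by_cases hgA : g ∈ A
    · simp [restrict, hgA]
    · have := hsupp x g (by simp [hg, hgA])
      simp [restrict, Finsupp.filter_apply, this]
  -- Each generator misses one of the two pieces of `v`; since it commutes with their sum, it
  -- commutes with the other piece as well.
  have h0 : ∀ i g, bform (translate g (H.gen.col i)) (restrict A v) = 0 ∧
      bform (translate g (H.gen.col i)) (restrict Aᶜ v) = 0 := by
    intro i g
    have h1 := H.mem_perp_iff.mp hv i g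
    rw [← restrict_add_compl A v, bform_add_right] at h1
    rcases h i g with h2 | h2
    · have h3 := bform_eq_zero_of_disjoint disjoint_compl_left h2 (supp_restrict A v)
      rw [h3, zero_add] at h1
      exact ⟨h3, h1⟩
    · have h3 := bform_eq_zero_of_disjoint disjoint_compl_left h2 hsuppB
      rw [h3, add_zero] at h1
      exact ⟨h1, h3⟩
  rw [← restrict_add_compl A v]
  exact add_mem (hA _ (H.mem_perp_iff.mpr fun i g => (h0 i g).1) (supp_restrict A v))
    (hB _ (H.mem_perp_iff.mpr fun i g => (h0 i g).2) hsuppB)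

lemma CodeHamiltonian.Correctable.mono {Λ : Type} [AddCommGroup Λ]
    {H : CodeHamiltonian Λ q t} {A B : Set Λ} (hB : H.Correctable B) (h : A ⊆ B) :
    H.Correctable A := fun v hv hs => hB v hv (hs.mono h)

/-- The interval of the sites `a, …, b - 1`. -/
def segment (L a b : ℕ) [NeZero L] : Set (ZMod L) := {g | a ≤ g.val ∧ g.val < b}

lemma segment_subset_interval {a b n : ℕ} (hab : b ≤ a + n) :
    segment L a b ⊆ interval (a : ZMod L) n := by
  rintro g ⟨h1, h2⟩
  refine ⟨g.val - a, by omega, ?_⟩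
  rw [← Nat.cast_add, Nat.add_sub_cancel' h1, ZMod.natCast_zmod_val]

/-- If every interval of half the length of the ring is correctable, and the range of the generators
is small compared to it, then the ground space is nondegenerate. -/
lemma CodeHamiltonian.perp_le_of_interval {H : CodeHamiltonian (ZMod L) q t} {r : ℕ}
    (hr : ∀ i g, ∃ g₀ : ZMod L, ∀ x k, ((translate g (H.gen.col i)) x).coeff k ≠ 0 →
      ∃ d : ℤ, |d| ≤ r ∧ k = g₀ + d)
    (hL : 8 * r + 6 ≤ L) (h : ∀ o, H.Correctable (interval o (L / 2))) :
    perp H.stabilizerModule ≤ H.stabilizerModule := by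
  set n := L / 2 with hn
  -- Two sites of one generator are at distance at most `2 * r`, so a gap of width `w` cannot be
  -- bridged.
  set w := 2 * r + 1 with hw
  have hseg : ∀ a b, b ≤ a + n → H.Correctable (segment L a b) := fun a b hab =>
    (h a).mono (segment_subset_interval hab)
  have hunion : ∀ a b c d : ℕ, b + w ≤ c → d + w ≤ L + a → b ≤ a + n → d ≤ c + n →
      H.Correctable (segment L a b ∪ segment L c d) := by
    intro a b c d h1 h2 h3 h4
    refine (hseg a b h3).union (hseg c d h4) ?_
    · intro i g
      by_contra! hcon
      obtain ⟨hA, hB⟩ := hcon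
      simp only [Supp, Set.mem_compl_iff, not_not, not_forall] at hA hB
      obtain ⟨x, k, hk, hxk⟩ := hA
      obtain ⟨y, l, hl, hyl⟩ := hB
      obtain ⟨g₀, hg₀⟩ := hr i g
      obtain ⟨d1, hd1, e1⟩ := hg₀ x k hxk
      obtain ⟨d2, hd2, e2⟩ := hg₀ y l hyl
      have e3 : (((l.val : ℤ) - k.val - (d2 - d1) : ℤ) : ZMod L) = 0 := by
        push_cast
        rw [ZMod.natCast_zmod_val, ZMod.natCast_zmod_val, e1, e2]; ring
      obtain ⟨m, hm⟩ := (ZMod.intCast_zmod_eq_zero_iff_dvd _ _).mp e3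
      obtain ⟨hk1, hk2⟩ := hk
      obtain ⟨hl1, hl2⟩ := hl
      rw [abs_le] at hd1 hd2
      -- The gap from `b` to `c` excludes `m ≤ 0`; the gap across the end of the ring, from `d` to
      -- `L + a`, excludes `m ≥ 1`.
      have hm1 : 0 < m := by
        by_contra! hm0
        have : (L : ℤ) * m ≤ 0 := mul_nonpos_of_nonneg_of_nonpos (by positivity) hm0
        omega
      have hm2 : (L : ℤ) * 1 ≤ L * m := by gcongr; omega
      omega
  -- The arcs `[0, w)`, `[w, n)`, `[n, n + w)`, `[n + w, L)` alternate between the two regions. The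
  -- last one has at most `n` sites even for odd `L`, because `w ≥ 1`.
  have h1 := hunion w n (n + w) L (by omega) (by omega) (by omega) (by omega)
  have h2 := hunion 0 w n (n + w) (by omega) (by omega) (by omega) (by omega)
  refine h2.perp_le (h1.mono fun g hg => ?_)
  simp only [segment, Set.mem_compl_iff, Set.mem_union, Set.mem_ofPred_eq, not_or] at hg ⊢
  have := ZMod.val_lt g
  omega

end Cleaning

/-! ### Topological order -/

section TopologicalOrder

variable {L q t : ℕ} [NeZero L]

/-- The matrix is a signed permutation matrix whose shift and signs involve only the bits in `A`. -/
lemma supportedOn_pauliOp {A : Set (ZMod L)} {v : PauliModule (ZMod L) q} (hv : Supp A v) :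
    SupportedOn A (LinearMap.toMatrix' (pauliOp v)) := by
  classical
  refine ⟨fun t t' => if t' = t + (fun a i => config (xPart v) a i : Config A q) then
    sgn (∑ g : A, ∑ i, (zPart v i).coeff g * t' g i) else 0, fun s s' => ?_⟩
  have hO : LinearMap.toMatrix' (pauliOp v) s s' =
      if s' = s + config (xPart v) then sgn (parity (zPart v) s') else 0 := by
    rw [LinearMap.toMatrix'_apply, pauliOp_apply]
    by_cases h : s' = s + config (xPart v)
    · simp [h]
    · simp [h, Ne.symm h]
  have hx : ∀ g ∉ A, config (xPart v) g = 0 := fun g hg => funext fun i => hv _ g hg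
  have hz : parity (zPart v) s' = ∑ g : A, ∑ i, (zPart v i).coeff g * s' g i := by
    rw [parity_eq_sum, ← Fintype.sum_subtype_add_sum_subtype (· ∈ A), add_eq_left]
    exact Finset.sum_eq_zero fun g _ => Finset.sum_eq_zero fun i _ => by
      have : (zPart v i).coeff g = 0 := hv _ g g.2
      rw [this, zero_mul]
  rw [hO, hz]
  have hiff : s' = s + config (xPart v) ↔ (∀ g, g ∉ A → s g = s' g) ∧
      (fun a : A => s' a) = (fun a : A => s a) + fun a : A => config (xPart v) a := by
    constructor
    · rintro rfl
      refine ⟨fun g hg => by simp [hx g hg], rfl⟩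
    · rintro ⟨h1, h2⟩
      ext1 g
      by_cases hg : g ∈ A
      · exact congrFun h2 ⟨g, hg⟩
      · simp [hx g hg, h1 g hg]
  by_cases h1 : ∀ g, g ∉ A → s g = s' g
  · by_cases h2 : (fun a : A => s' a) = (fun a : A => s a) + fun a : A => config (xPart v) a
    · rw [if_pos (hiff.mpr ⟨h1, h2⟩), if_pos h1]; exact (if_pos h2).symm
    · rw [if_neg fun h => h2 (hiff.mp h).2, if_pos h1]; exact (if_neg h2).symm
  · rw [if_neg fun h => h1 (hiff.mp h).1, if_neg h1]

/-- A logical operator preserves the ground space, so topological order would make it a scalar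
there; a nontrivial one is not, because another logical operator anticommutes with it. -/
lemma CodeHamiltonian.TopologicallyOrdered.correctable {H : CodeHamiltonian (ZMod L) q t}
    (h : H.TopologicallyOrdered) (o : ZMod L) : H.Correctable (interval o (L / 2)) := by
  intro v hv hs
  by_contra hvS
  obtain ⟨w, hw, hwv⟩ := exists_mem_perp_bform_ne_zero hvS
  rw [bform_comm] at hwv
  obtain ⟨c, hc⟩ := h o _ (supportedOn_pauliOp hs)
  refine not_scalar_of_bform hw hwv c fun ψ hψ => ?_
  have h1 : ∀ φ ∈ H.groundSpace, H.groundProj (WithLp.toLp 2 φ) = WithLp.toLp 2 φ := by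
    intro φ hφ
    exact Submodule.starProjection_eq_self_iff.mpr hφ
  have h2 := congrArg (fun f => f (WithLp.toLp 2 ψ)) hc
  simp only [mul_apply_eq_comp, h1 ψ hψ, Matrix.toEuclideanCLM_toLp,
    smul_apply] at h2
  rw [← Matrix.toLin'_apply, Matrix.toLin'_toMatrix', h1 _ (pauliOp_mem_groundSpace hv hψ)] at h2
  exact congrArg WithLp.ofLp h2

end TopologicalOrder

/-! ### Laurent polynomials over `𝔽₂` -/

section Laurent

open LaurentPolynomial

/-- Laurent polynomials are a localization of `𝔽₂[X]`, and every ideal of a localization is extended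
from the original ring. -/
instance : IsPrincipalIdealRing (LaurentPolynomial (ZMod 2)) where
  principal I := by
    obtain ⟨a, ha⟩ := IsPrincipalIdealRing.principal
      (I.under (Polynomial (ZMod 2)))
    refine ⟨algebraMap _ _ a, ?_⟩
    rw [← IsLocalization.map_under (Submonoid.powers (Polynomial.X : Polynomial (ZMod 2))) _ I, ha]
    exact (Ideal.map_span _ _).trans (by rw [Set.image_singleton])

/-- `x` has finite order modulo any nonzero Laurent polynomial. -/
lemma exists_dvd_T_sub_one {r : LaurentPolynomial (ZMod 2)} (hr : r ≠ 0) :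
    ∃ n : ℕ, 0 < n ∧ r ∣ T (n : ℤ) - 1 := by
  obtain ⟨m, p, hp⟩ := r.exists_T_pow
  have hp0 : p ≠ 0 := by
    rintro rfl
    rw [map_zero] at hp
    exact mul_ne_zero hr (isUnit_T _).ne_zero hp.symm
  have : Module.Finite (ZMod 2) (AdjoinRoot p) := (AdjoinRoot.powerBasis hp0).finite
  have : Finite (AdjoinRoot p) := Module.finite_of_finite (ZMod 2)
  -- The residue ring is finite, so two powers of the root coincide; in the Laurent ring the smaller
  -- power is a unit and can be cancelled.
  obtain ⟨i, j, hij, h⟩ := Finite.exists_ne_map_eq_of_infinite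
    fun n : ℕ => (AdjoinRoot.root p) ^ n
  wlog hlt : i < j generalizing i j
  · exact this j i hij.symm h.symm (by omega)
  refine ⟨j - i, by omega, ?_⟩
  have h1 : p ∣ Polynomial.X ^ j - Polynomial.X ^ i := by
    rw [← AdjoinRoot.mk_eq_zero, map_sub, map_pow, map_pow, AdjoinRoot.mk_X, sub_eq_zero]
    exact h.symm
  have h2 := map_dvd Polynomial.toLaurent h1
  rw [hp, map_sub, Polynomial.toLaurent_X_pow, Polynomial.toLaurent_X_pow] at h2
  have h3 : (T (j : ℤ) - T (i : ℤ) : LaurentPolynomial (ZMod 2)) =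
      T (i : ℤ) * (T ((j - i : ℕ) : ℤ) - 1) := by
    rw [mul_sub, mul_one, ← T_add]
    congr 2
    omega
  rw [h3] at h2
  exact (isUnit_T _).dvd_mul_left.mp ((dvd_mul_right _ _).trans h2)

lemma T_sub_one_dvd (n m : ℤ) (h : n ∣ m) :
    (T n - 1 : LaurentPolynomial (ZMod 2)) ∣ T m - 1 := by
  obtain ⟨k, rfl⟩ := h
  have hpos : ∀ k : ℕ, (T n - 1 : LaurentPolynomial (ZMod 2)) ∣ T (n * k) - 1 := fun k => by
    have := sub_one_dvd_pow_sub_one (T n : LaurentPolynomial (ZMod 2)) k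
    rwa [T_pow, mul_comm] at this
  obtain ⟨k, rfl | rfl⟩ := k.eq_nat_or_neg
  · exact hpos k
  · refine (isUnit_T (n * k)).dvd_mul_left.mp ?_
    rw [mul_sub, ← T_add, mul_neg, add_neg_cancel, T_zero, mul_one, ← dvd_neg, neg_sub]
    exact hpos k

lemma T_sub_one_ne_zero {n : ℕ} (hn : 0 < n) :
    (T (n : ℤ) - 1 : LaurentPolynomial (ZMod 2)) ≠ 0 := by
  intro h
  have h1 := congrArg (fun f : LaurentPolynomial (ZMod 2) => f.coeff (n : ℤ)) (sub_eq_zero.mp h)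
  rw [← T_zero] at h1
  simp only [T_apply] at h1
  rw [if_pos trivial, if_neg (by omega)] at h1
  exact one_ne_zero h1

/-- The reduction `𝔽₂[ℤ] → 𝔽₂[ℤ/L]`. -/
abbrev red (L : ℕ) : LaurentPolynomial (ZMod 2) →+* AddMonoidAlgebra (ZMod 2) (ZMod L) :=
  AddMonoidAlgebra.mapDomainRingHom (ZMod 2) (Int.castAddHom (ZMod L))

lemma red_single (L : ℕ) (n : ℤ) (c : ZMod 2) : red L (single n c) = single (n : ZMod L) c :=
  AddMonoidAlgebra.mapDomain_single

lemma red_surjective (L : ℕ) : Function.Surjective (red L) := by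
  intro a
  induction a using AddMonoidAlgebra.induction_linear with
  | zero => exact ⟨0, map_zero _⟩
  | add f g hf hg =>
    obtain ⟨f, rfl⟩ := hf
    obtain ⟨g, rfl⟩ := hg
    exact ⟨f + g, map_add _ _ _⟩
  | single g c =>
    obtain ⟨n, rfl⟩ := ZMod.intCast_surjective g
    exact ⟨single n c, red_single _ _ _⟩

lemma red_T_sub_one (L : ℕ) : red L (T (L : ℤ) - 1) = 0 := by
  rw [map_sub, map_one, T, red_single, sub_eq_zero]
  simp [AddMonoidAlgebra.one_def]

/-- The kernel of the reduction is generated by `x^L - 1`. -/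
lemma dvd_of_red_eq_zero {L : ℕ} [NeZero L] {a : LaurentPolynomial (ZMod 2)} (h : red L a = 0) :
    T (L : ℤ) - 1 ∣ a := by
  -- Modulo `x^L - 1`, every `a` agrees with the lift of its reduction to exponents in `[0, L)`; the
  -- lift of zero is zero.
  have key : ∀ a : LaurentPolynomial (ZMod 2),
      T (L : ℤ) - 1 ∣ a - AddMonoidAlgebra.mapDomain (fun g : ZMod L => (g.val : ℤ)) (red L a) := by
    intro a
    induction a using AddMonoidAlgebra.induction_linear with
    | zero => simp
    | add f g hf hg =>
      rw [map_add, AddMonoidAlgebra.mapDomain_add, add_sub_add_comm]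
      exact dvd_add hf hg
    | single n c =>
      rw [red_single, AddMonoidAlgebra.mapDomain_single]
      obtain ⟨k, hk⟩ : (L : ℤ) ∣ n - ((n : ZMod L).val : ℤ) := by
        rw [← ZMod.intCast_zmod_eq_zero_iff_dvd]
        push_cast
        rw [ZMod.natCast_zmod_val, sub_self]
      generalize ((n : ZMod L).val : ℤ) = m at hk ⊢
      obtain rfl : n = m + L * k := by omega
      have : (single (m + L * k) c - single m c : LaurentPolynomial (ZMod 2)) =
          single m c * (T (L * k) - 1) := by
        rw [mul_sub, mul_one, T, AddMonoidAlgebra.single_mul_single, mul_one]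
      rw [this]
      exact (T_sub_one_dvd _ _ (dvd_mul_right _ _)).mul_left _
  have := key a
  rw [h, AddMonoidAlgebra.mapDomain_zero, sub_zero] at this
  exact this

lemma antipode_red (L : ℕ) (a : LaurentPolynomial (ZMod 2)) :
    antipode (ZMod L) (red L a) = red L (antipode ℤ a) := by
  induction a using AddMonoidAlgebra.induction_linear with
  | zero => simp
  | add f g hf hg => simp only [map_add, hf, hg]
  | single n c => rw [red_single, antipode_single, antipode_single, red_single, Int.cast_neg]

end Laurent

/-! ### Periodic boundary conditions -/

section Periodic

open LaurentPolynomial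

variable {q t : ℕ}

/-- The reduction of an element of the Pauli module. -/
def redP (L : ℕ) (v : PauliModule ℤ q) : PauliModule (ZMod L) q := fun x => red L (v x)

lemma omega_redP (L : ℕ) (u v : PauliModule ℤ q) :
    omega (redP L u) (redP L v) = red L (omega u v) := by
  simp only [omega, map_sum, redP, map_add, map_mul, antipode_red]

variable {H : CodeHamiltonian ℤ q t} {L : ℕ} {H_L : CodeHamiltonian (ZMod L) q t}

lemma IsPeriodic.col (h : IsPeriodic H L H_L) (i : Fin t) :
    H_L.gen.col i = redP L (H.gen.col i) := by
  rw [h]; rfl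

lemma IsPeriodic.redP_mem_perp (h : IsPeriodic H L H_L) {v : PauliModule ℤ q}
    (hv : v ∈ perp H.stabilizerModule) : redP L v ∈ perp H_L.stabilizerModule := by
  rw [CodeHamiltonian.mem_perp_iff_omega] at hv ⊢
  intro i
  rw [h.col, omega_redP, hv i, map_zero]

lemma IsPeriodic.exists_redP (h : IsPeriodic H L H_L) {w : PauliModule (ZMod L) q}
    (hw : w ∈ H_L.stabilizerModule) : ∃ s ∈ H.stabilizerModule, w = redP L s := by
  induction hw using Submodule.span_induction with
  | mem x hx =>
    obtain ⟨i, rfl⟩ := hx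
    exact ⟨_, Submodule.subset_span ⟨i, rfl⟩, h.col i⟩
  | zero => exact ⟨0, zero_mem _, by ext1 x; simp [redP]⟩
  | add x y _ _ hx hy =>
    obtain ⟨s, hs, rfl⟩ := hx
    obtain ⟨s', hs', rfl⟩ := hy
    exact ⟨s + s', add_mem hs hs', funext fun x => (map_add (red L) _ _).symm⟩
  | smul r x _ hx =>
    obtain ⟨s, hs, rfl⟩ := hx
    obtain ⟨r, rfl⟩ := red_surjective L r
    exact ⟨r • s, Submodule.smul_mem _ _ hs, funext fun x => (map_mul (red L) _ _).symm⟩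

lemma CodeHamiltonian.exists_range (H : CodeHamiltonian ℤ q t) :
    ∃ r : ℕ, ∀ i x n, ((H.gen.col i) x).coeff n ≠ 0 → |n| ≤ r := by
  classical
  refine ⟨∑ i, ∑ x, ∑ n ∈ ((H.gen.col i) x).coeff.support, n.natAbs, fun i x n hn => ?_⟩
  have h1 : n.natAbs ≤ ∑ i, ∑ x, ∑ n ∈ ((H.gen.col i) x).coeff.support, n.natAbs :=
    calc n.natAbs ≤ ∑ n ∈ ((H.gen.col i) x).coeff.support, n.natAbs :=
          Finset.single_le_sum (f := fun n : ℤ => n.natAbs) (fun _ _ => Nat.zero_le _)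
            (Finsupp.mem_support_iff.mpr hn)
      _ ≤ ∑ x, ∑ n ∈ ((H.gen.col i) x).coeff.support, n.natAbs :=
          Finset.single_le_sum (f := fun x => ∑ n ∈ ((H.gen.col i) x).coeff.support, n.natAbs)
            (fun _ _ => Nat.zero_le _) (Finset.mem_univ x)
      _ ≤ _ := Finset.single_le_sum
            (f := fun i => ∑ x, ∑ n ∈ ((H.gen.col i) x).coeff.support, n.natAbs)
            (fun _ _ => Nat.zero_le _) (Finset.mem_univ i)
  rw [Int.abs_eq_natAbs]
  exact_mod_cast h1

/-- Degenerate Hamiltonians are not topologically ordered on large rings. -/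
theorem CodeHamiltonian.exists_not_topologicallyOrdered (H : CodeHamiltonian ℤ q t) :
    ∃ L₀ : ℕ, ∀ (L : ℕ) [NeZero L], L₀ ≤ L →
      ∀ H_L : CodeHamiltonian (ZMod L) q t, IsPeriodic H L H_L →
        1 < Module.finrank ℂ H_L.groundSpace → ¬ H_L.TopologicallyOrdered := by
  obtain ⟨r, hr⟩ := H.exists_range
  refine ⟨8 * r + 6, fun L _ hL H_L hper hdeg htop => ?_⟩
  refine absurd (finrank_le_one (perp_le_of_interval (r := r) (fun i g => ⟨g, fun x k hk => ?_⟩) hL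
    htop.correctable)) (not_le.mpr hdeg)
  rw [hper.col, translate, Pi.smul_apply, smul_eq_mul,
    AddMonoidAlgebra.coeff_single_mul_apply, one_mul] at hk
  -- A nonzero coefficient of the reduced column comes from some exponent of the original column in
  -- the same residue class, and that exponent is bounded by `r`.
  have h1 : -g + k ∈ (Finsupp.mapDomain (Int.castAddHom (ZMod L))
      ((H.gen.col i) x).coeff).support := Finsupp.mem_support_iff.mpr hk
  classical
  obtain ⟨n, hn, hnk⟩ := Finset.mem_image.mp (Finsupp.mapDomain_support h1)
  refine ⟨n, hr i x n (Finsupp.mem_support_iff.mp hn), ?_⟩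
  rw [eq_neg_add_iff_add_eq] at hnk
  exact hnk.symm

lemma exists_redP_notMem {v : PauliModule ℤ q} (hv : v ∈ perp H.stabilizerModule)
    (hvS : v ∉ H.stabilizerModule) (N : ℕ) :
    ∃ L : ℕ, N ≤ L ∧ 0 < L ∧ ∃ u ∈ perp H.stabilizerModule,
      ∀ H_L : CodeHamiltonian (ZMod L) q t, IsPeriodic H L H_L →
        redP L u ∉ H_L.stabilizerModule := by
  set S := H.stabilizerModule with hS
  have main : ∃ L : ℕ, N ≤ L ∧ 0 < L ∧
      ¬ perp S ≤ S ⊔ Ideal.span {(T (L : ℤ) - 1 : LaurentPolynomial (ZMod 2))} • perp S := by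
    by_contra! hcon
    have h1 := hcon (N + 1) (by omega) (by omega)
    -- Nakayama gives `r ≡ 1` modulo `x^(N+1) - 1` with `r • perp S ≤ S`. The second ring length is
    -- chosen so that `r` divides `x^L - 1`; then the summand `(x^L - 1) • perp S` already lies in
    -- `S`, forcing `perp S ≤ S`.
    obtain ⟨r, hr1, hr2⟩ := Submodule.exists_sub_one_mem_and_smul_le_of_fg_of_le_sup
      (IsNoetherian.noetherian (perp S)) le_rfl h1
    have hr0 : r ≠ 0 := by
      rintro rfl
      obtain ⟨c, hc⟩ := Ideal.mem_span_singleton.mp hr1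
      have h2 := congrArg (red (N + 1)) hc
      rw [map_mul, red_T_sub_one, zero_mul, zero_sub, map_neg, map_one, neg_eq_zero] at h2
      exact one_ne_zero h2
    obtain ⟨n, hn, hdvd⟩ := exists_dvd_T_sub_one hr0
    have h2 := hcon (n * (N + 1)) (by nlinarith) (by positivity)
    have h3 : r ∣ T ((n * (N + 1) : ℕ) : ℤ) - 1 :=
      hdvd.trans (T_sub_one_dvd _ _ ⟨N + 1, by push_cast; ring⟩)
    refine hvS ((h2.trans ?_ : perp S ≤ S) hv)
    refine (sup_le le_rfl (Submodule.smul_le.mpr fun a ha w hw => ?_))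
    obtain ⟨b, rfl⟩ := h3.trans (Ideal.mem_span_singleton.mp ha)
    rw [mul_comm, mul_smul]
    exact S.smul_mem _ (hr2 (Submodule.smul_mem_pointwise_smul _ _ _ hw))
  obtain ⟨L, hNL, hL, hnot⟩ := main
  obtain ⟨u, hu, huS⟩ := SetLike.not_le_iff_exists.mp hnot
  have : NeZero L := ⟨hL.ne'⟩
  refine ⟨L, hNL, hL, u, hu, fun H_L hper hmem => huS ?_⟩
  obtain ⟨s, hs, hus⟩ := hper.exists_redP hmem
  have h1 : ∀ x, T (L : ℤ) - 1 ∣ (u - s) x := fun x => by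
    refine dvd_of_red_eq_zero ?_
    rw [Pi.sub_apply, map_sub, sub_eq_zero]
    exact congrFun hus x
  choose w hw using h1
  have h2 : u - s = (T (L : ℤ) - 1 : LaurentPolynomial (ZMod 2)) • w := funext hw
  have h3 : w ∈ perp S := fun y hy => by
    have h4 := sub_mem hu (H.stabilizerModule_le_perp hs) y hy
    rw [h2, omega_smul_right] at h4
    exact (mul_eq_zero.mp h4).resolve_left (T_sub_one_ne_zero hL)
  rw [← add_sub_cancel s u, h2]
  exact add_mem (Submodule.mem_sup_left hs) (Submodule.mem_sup_right
    (Submodule.smul_mem_smul (Ideal.mem_span_singleton_self _) h3))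

lemma exists_one_lt_finrank {v : PauliModule ℤ q} (hv : v ∈ perp H.stabilizerModule)
    (hvS : v ∉ H.stabilizerModule) (N : ℕ) :
    ∃ L : ℕ, ∃ _ : NeZero L, N ≤ L ∧
      ∀ H_L : CodeHamiltonian (ZMod L) q t, IsPeriodic H L H_L →
        1 < Module.finrank ℂ H_L.groundSpace := by
  obtain ⟨L, hNL, hL, u, hu, h⟩ := exists_redP_notMem hv hvS N
  have : NeZero L := ⟨hL.ne'⟩
  exact ⟨L, this, hNL, fun H_L hper =>
    CodeHamiltonian.one_lt_finrank (hper.redP_mem_perp hu) (h H_L hper)⟩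

end Periodic

/-! ### Saturated and Lagrangian submodules -/

section Saturation

open LaurentPolynomial

variable {q : ℕ}

/-- The saturation of a submodule. -/
def sat (S : Submodule (LaurentPolynomial (ZMod 2)) (PauliModule ℤ q)) :
    Submodule (LaurentPolynomial (ZMod 2)) (PauliModule ℤ q) where
  carrier := {v | ∃ r : LaurentPolynomial (ZMod 2), r ≠ 0 ∧ r • v ∈ S}
  add_mem' := by
    rintro u v ⟨r, hr, hu⟩ ⟨r', hr', hv⟩
    refine ⟨r * r', mul_ne_zero hr hr', ?_⟩
    rw [smul_add]
    refine add_mem ?_ ?_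
    · rw [mul_comm, mul_smul]; exact S.smul_mem _ hu
    · rw [mul_smul]; exact S.smul_mem _ hv
  zero_mem' := ⟨1, one_ne_zero, by simp⟩
  smul_mem' := by
    rintro a v ⟨r, hr, hv⟩
    exact ⟨r, hr, by rw [smul_comm]; exact S.smul_mem _ hv⟩

variable {S K : Submodule (LaurentPolynomial (ZMod 2)) (PauliModule ℤ q)}

lemma le_sat : S ≤ sat S := fun v hv => ⟨1, one_ne_zero, by simpa using hv⟩

/-- Nonzero multipliers come out of the form as nonzero factors, which cancel in a domain. -/
lemma sat_le_perp_sat (h : S ≤ perp S) : sat S ≤ perp (sat S) := by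
  rintro v ⟨r, hr, hv⟩ u ⟨a, ha, hu⟩
  have h1 := h hv _ hu
  rw [omega_smul_left, omega_smul_right] at h1
  have h2 : antipode ℤ a ≠ 0 := (map_ne_zero_iff _ antipode_injective).mpr ha
  exact (mul_eq_zero.mp ((mul_eq_zero.mp h1).resolve_left h2)).resolve_left hr

/-- The saturation of `S` is annihilated by some `x^c - 1` modulo `S`. -/
lemma exists_T_sub_one_smul_mem (S : Submodule (LaurentPolynomial (ZMod 2)) (PauliModule ℤ q)) :
    ∃ c : ℕ, 0 < c ∧ ∀ v ∈ sat S, (T (c : ℤ) - 1 : LaurentPolynomial (ZMod 2)) • v ∈ S := by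
  classical
  obtain ⟨G, hG⟩ := IsNoetherian.noetherian (sat S)
  have key : ∀ G : Finset (PauliModule ℤ q), (∀ v ∈ G, v ∈ sat S) →
      ∃ r : LaurentPolynomial (ZMod 2), r ≠ 0 ∧ ∀ v ∈ G, r • v ∈ S := by
    intro G
    induction G using Finset.induction_on with
    | empty => exact fun _ => ⟨1, one_ne_zero, by simp⟩
    | insert v G _ ih =>
      intro h
      obtain ⟨r, hr, hG⟩ := ih fun v hv => h v (Finset.mem_insert_of_mem hv)
      obtain ⟨a, ha, hv⟩ := h v (Finset.mem_insert_self v G)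
      refine ⟨r * a, mul_ne_zero hr ha, fun w hw => ?_⟩
      rcases Finset.mem_insert.mp hw with rfl | hw
      · rw [mul_smul]; exact S.smul_mem _ hv
      · rw [mul_comm, mul_smul]; exact S.smul_mem _ (hG w hw)
  obtain ⟨r, hr, hrG⟩ := key G fun v hv => hG ▸ Submodule.subset_span hv
  obtain ⟨c, hc, a, hca⟩ := exists_dvd_T_sub_one hr
  refine ⟨c, hc, fun v hv => ?_⟩
  rw [← hG] at hv
  rw [hca, mul_comm, mul_smul]
  refine S.smul_mem _ ?_
  induction hv using Submodule.span_induction with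
  | mem x hx => exact hrG x hx
  | zero => simp
  | add x y _ _ hx hy => rw [smul_add]; exact add_mem hx hy
  | smul b x _ hx => rw [smul_comm]; exact S.smul_mem _ hx

lemma free_quotient (hK : sat K ≤ K) :
    Module.Free (LaurentPolynomial (ZMod 2)) (PauliModule ℤ q ⧸ K) := by
  have : Module.IsTorsionFree (LaurentPolynomial (ZMod 2)) (PauliModule ℤ q ⧸ K) := by
    refine .of_smul_eq_zero fun r m h => ?_
    obtain ⟨v, rfl⟩ := K.mkQ_surjective m
    rw [← map_smul, Submodule.mkQ_apply, Submodule.Quotient.mk_eq_zero] at h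
    by_contra! hne
    refine hne.2 ?_
    rw [Submodule.mkQ_apply, Submodule.Quotient.mk_eq_zero]
    exact hK ⟨r, hne.1, h⟩
  exact Module.free_of_finite_type_torsion_free'

/-- The symplectic form is unimodular. -/
lemma exists_eq_omega
    (φ : PauliModule ℤ q →ₗ[LaurentPolynomial (ZMod 2)] LaurentPolynomial (ZMod 2)) :
    ∃ c : PauliModule ℤ q, ∀ v, φ v = omega c v := by
  classical
  refine ⟨fun x => antipode ℤ (φ (Pi.single x.swap 1)), fun v => ?_⟩
  have h : φ = omegaRight (fun x => antipode ℤ (φ (Pi.single x.swap 1))) := by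
    refine (Pi.basisFun (LaurentPolynomial (ZMod 2)) (Fin q ⊕ Fin q)).ext fun x => ?_
    rw [Pi.basisFun_apply, omegaRight_apply, omega_single, antipode_antipode, Sum.swap_swap,
      mul_one]
  exact LinearMap.congr_fun h v

lemma perp_perp_le (S : Submodule (LaurentPolynomial (ZMod 2)) (PauliModule ℤ q)) :
    perp (perp S) ≤ sat S := by
  intro v hv
  by_contra hvS
  have hsat : sat (sat S) ≤ sat S := by
    rintro w ⟨r, hr, a, ha, h⟩
    exact ⟨a * r, mul_ne_zero ha hr, by rwa [mul_smul]⟩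
  have := free_quotient hsat
  have h1 : (sat S).mkQ v ≠ 0 := by
    rwa [Submodule.mkQ_apply, Ne, Submodule.Quotient.mk_eq_zero]
  -- The quotient by `sat S` is free, so a functional separates `v` from `sat S`; by unimodularity
  -- it is `omega c` with `c` in `perp S`.
  rw [Ne, ← Module.forall_dual_apply_eq_zero_iff (LaurentPolynomial (ZMod 2))] at h1
  push Not at h1
  obtain ⟨φ, hφ⟩ := h1
  obtain ⟨c, hc⟩ := exists_eq_omega (φ ∘ₗ (sat S).mkQ)
  refine hφ ((hc v).trans (hv c fun u hu => ?_))
  rw [omega_eq_zero_comm, ← hc u, LinearMap.comp_apply, Submodule.mkQ_apply,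
    (Submodule.Quotient.mk_eq_zero _).mpr (le_sat hu), map_zero]

/-- Every isotropic submodule is contained in a Lagrangian one. -/
lemma exists_lagrangian (hS : S ≤ perp S) : ∃ K, S ≤ K ∧ K = perp K := by
  obtain ⟨K, ⟨hSK, hK⟩, hmax⟩ := WellFounded.has_min
    (wellFounded_gt (α := Submodule (LaurentPolynomial (ZMod 2)) (PauliModule ℤ q)))
    {K | S ≤ K ∧ K ≤ perp K} ⟨S, le_rfl, hS⟩
  have hmax' : ∀ K', K ≤ K' → K' ≤ perp K' → K' ≤ K := by
    intro K' hKK' hK'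
    by_contra hnot
    exact hmax K' ⟨hSK.trans hKK', hK'⟩ (lt_of_le_not_ge hKK' hnot)
  refine ⟨K, hSK, le_antisymm hK ?_⟩
  -- Adjoining to `K` an arbitrary `v` orthogonal to it may break isotropy, as `omega v v` need not
  -- vanish. Comparison with the known Lagrangian `X` of `σ_x`-type operators excludes such an
  -- anisotropic remainder.
  let X : Submodule (LaurentPolynomial (ZMod 2)) (PauliModule ℤ q) :=
    { carrier := {v | ∀ i, v (Sum.inr i) = 0}
      add_mem' := fun ha hb i => by simp [ha i, hb i]
      zero_mem' := fun i => rfl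
      smul_mem' := fun r v hv i => by simp [hv i] }
  have hX : X ≤ perp X := by
    intro v hv u hu
    exact Finset.sum_eq_zero fun i _ => by rw [hv i, hu i]; simp
  have hX' : perp X ≤ X := by
    intro v hv i
    have h := hv (Pi.single (Sum.inl i) 1) (fun j => by simp)
    rw [omega_eq_zero_comm, omega_single] at h
    simpa [map_eq_zero_iff _ antipode_injective] using h
  have hY : X ⊓ perp K ≤ K := by
    refine le_sup_right.trans (hmax' (K ⊔ X ⊓ perp K) le_sup_left ?_)
    intro v hv u hu
    obtain ⟨k, hk, x, hx, rfl⟩ := Submodule.mem_sup.mp hv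
    obtain ⟨k', hk', x', hx', rfl⟩ := Submodule.mem_sup.mp hu
    rw [omega_add_left, omega_add_right, omega_add_right, hK hk k' hk', hx.2 k' hk',
      omega_eq_zero_comm.mp (hx'.2 k hk), hX hx.1 x' hx'.1]
    simp
  intro v hv
  -- Here `perp (X ⊔ K) ≤ X ⊓ perp K ≤ K`, so `v` is in the double complement of `X ⊔ K` and a
  -- multiple of it is `x + k`. Then `x` is orthogonal to `K`, hence in `K`, and maximality absorbs
  -- the saturation of `K`.
  obtain ⟨r, hr, hrv⟩ := perp_perp_le (X ⊔ K) (x := v) fun u hu => hv u (hY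
    ⟨hX' fun w hw => hu w (Submodule.mem_sup_left hw), fun w hw => hu w (Submodule.mem_sup_right hw)⟩)
  obtain ⟨x, hx, k, hk, hxk⟩ := Submodule.mem_sup.mp hrv
  have hxK : x ∈ K := by
    refine hY ⟨hx, ?_⟩
    rw [← add_sub_cancel_right x k, hxk]
    exact sub_mem ((perp K).smul_mem _ hv) (hK hk)
  exact hmax' (sat K) le_sat (sat_le_perp_sat hK) ⟨r, hr, hxk ▸ add_mem hxK hk⟩

/-- Evaluation at `x = 1`. -/
def evalOne : LaurentPolynomial (ZMod 2) →+* ZMod 2 :=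
  (AddMonoidAlgebra.uniqueRingEquiv (ZMod 1)).toRingHom.comp (red 1)

lemma evalOne_eq_zero_iff {a : LaurentPolynomial (ZMod 2)} :
    evalOne a = 0 ↔ T 1 - 1 ∣ a := by
  constructor
  · intro h
    exact dvd_of_red_eq_zero (L := 1)
      ((map_eq_zero_iff _ (AddMonoidAlgebra.uniqueRingEquiv (ZMod 1)).injective).mp h)
  · rintro ⟨b, rfl⟩
    have : red 1 (T 1 - 1) = 0 := red_T_sub_one 1
    rw [map_mul, evalOne, RingHom.comp_apply, this, map_zero, zero_mul]

/-- This element generates the kernel of `evalOne`, whose target is a field. -/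
lemma irreducible_T_sub_one : Irreducible (T 1 - 1 : LaurentPolynomial (ZMod 2)) := by
  refine Prime.irreducible ⟨T_sub_one_ne_zero (n := 1) one_pos, fun h => ?_, fun a b h => ?_⟩
  · have := evalOne_eq_zero_iff.mpr (isUnit_iff_dvd_one.mp h)
    rw [map_one] at this
    exact one_ne_zero this
  · rw [← evalOne_eq_zero_iff] at h ⊢
    rw [← evalOne_eq_zero_iff]
    rwa [map_mul, mul_eq_zero] at h

lemma one_add_T_eq : (1 + T 1 : LaurentPolynomial (ZMod 2)) = T 1 - 1 := by
  rw [sub_eq_add_neg, add_comm]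
  congr 1
  ext n
  simp [CharTwo.neg_eq]

/-- If `(x - 1) sat S ⊆ S`, then a saturated module containing `S` has a basis such that `S` is
generated by multiples of basis elements by `1` or `1 + x`. -/
lemma exists_basis_of_T_sub_one_smul (hSK : S ≤ K)
    (h : ∀ v ∈ sat S, (T 1 - 1 : LaurentPolynomial (ZMod 2)) • v ∈ S) :
    ∃ (n p : ℕ) (b : Module.Basis (Fin n) (LaurentPolynomial (ZMod 2)) K) (f : Fin p ↪ Fin n)
      (a : Fin p → LaurentPolynomial (ZMod 2)), (∀ i, a i = 1 ∨ a i = 1 + T 1) ∧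
      S = Submodule.span _ (Set.range fun i => a i • (b (f i) : PauliModule ℤ q)) := by
  obtain ⟨n, b₀⟩ := Submodule.basisOfPid (Pi.basisFun (LaurentPolynomial (ZMod 2)) _) K
  obtain ⟨p, snf⟩ := Submodule.smithNormalForm b₀ (S.comap K.subtype)
  have hmem : ∀ i, snf.a i • (snf.bM (snf.f i) : PauliModule ℤ q) ∈ S := fun i => by
    have := (snf.bN i).2
    rw [snf.snf] at this
    exact this
  have ha0 : ∀ i, snf.a i ≠ 0 := fun i h0 => by
    have h1 := snf.snf i
    rw [h0, zero_smul] at h1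
    exact snf.bN.ne_zero i (Subtype.ext h1)
  -- As `snf.a i ≠ 0`, the basis vector itself is in `sat S`, so `x - 1` times it is in `S`, where
  -- its coordinate must be a multiple of `snf.a i`.
  have hdvd : ∀ i, snf.a i ∣ T 1 - 1 := fun i => by
    have h1 : (T 1 - 1 : LaurentPolynomial (ZMod 2)) • snf.bM (snf.f i) ∈ S.comap K.subtype :=
      h _ ⟨_, ha0 i, hmem i⟩
    have h2 := snf.repr_apply_embedding_eq_repr_smul (m := ⟨_, h1⟩) (i := i)
    rw [map_smul, map_smul] at h2
    simp only [Module.Basis.repr_self, Finsupp.smul_apply, Finsupp.single_eq_same, smul_eq_mul,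
      mul_one] at h2
    exact ⟨_, h2⟩
  have hassoc : ∀ i, ∃ a : LaurentPolynomial (ZMod 2), (a = 1 ∨ a = 1 + T 1) ∧
      Associated a (snf.a i) := fun i => by
    rcases irreducible_T_sub_one.dvd_iff.mp (hdvd i) with hu | hu
    · exact ⟨1, Or.inl rfl, (associated_one_iff_isUnit.mpr hu).symm⟩
    · exact ⟨1 + T 1, Or.inr rfl, one_add_T_eq ▸ hu⟩
  choose a ha haa using hassoc
  refine ⟨n, p, snf.bM, snf.f, a, ha, le_antisymm ?_ ?_⟩
  · intro v hv
    have h1 : (⟨v, hSK hv⟩ : K) ∈ S.comap K.subtype := hv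
    obtain ⟨c, hc⟩ := snf.bN.mem_submodule_iff.mp h1
    have h2 : v = c.sum fun i x => x • snf.a i • (snf.bM (snf.f i) : PauliModule ℤ q) := by
      have h3 := congrArg K.subtype hc
      rw [map_finsuppSum] at h3
      refine h3.trans (Finsupp.sum_congr fun i _ => ?_)
      rw [snf.snf]
      rfl
    rw [h2]
    refine Submodule.sum_mem _ fun i _ => Submodule.smul_mem _ _ ?_
    obtain ⟨d, hd⟩ := (haa i).dvd
    rw [hd, mul_comm, mul_smul]
    exact Submodule.smul_mem _ _ (Submodule.subset_span ⟨i, rfl⟩)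
  · rw [Submodule.span_le]
    rintro _ ⟨i, rfl⟩
    obtain ⟨d, hd⟩ := (haa i).symm.dvd
    simp only [hd, mul_comm (snf.a i), mul_smul]
    exact S.smul_mem _ (hmem i)

end Saturation

/-! ### Symplectic bases -/

section Symplectic

open LaurentPolynomial

variable {q : ℕ}

lemma invert_eq_antipode (a : LaurentPolynomial (ZMod 2)) : invert a = antipode ℤ a := by
  ext n; simp

lemma omega_eq_dotProduct (u v : PauliModule ℤ q) :
    omega u v = (fun x => invert (u x)) ⬝ᵥ (lam q).mulVec v := by
  have h : (lam q).mulVec v = fun x => v x.swap := by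
    rw [lam, Matrix.fromBlocks_mulVec]
    funext x
    rcases x with i | i
    · simp
    · have : -v (Sum.inl i) = v (Sum.inl i) := by ext n; simp [CharTwo.neg_eq]
      simp [Matrix.neg_mulVec, this]
  rw [h]
  simp [omega, dotProduct, Fintype.sum_sum_type, Finset.sum_add_distrib, invert_eq_antipode]

lemma isSymplectic_toMatrix'
    (Φ : PauliModule ℤ q →ₗ[LaurentPolynomial (ZMod 2)] PauliModule ℤ q)
    (h : ∀ u v, omega (Φ u) (Φ v) = omega u v) : IsSymplectic (LinearMap.toMatrix' Φ) := by
  ext1 x y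
  have h1 : ∀ x, (LinearMap.toMatrix' Φ).col x = Φ (Pi.single x 1) := fun x => by
    ext1 y; simp [Matrix.col, LinearMap.toMatrix'_apply]
  have h2 := h (Pi.single x 1) (Pi.single y 1)
  rw [omega_eq_dotProduct, omega_eq_dotProduct, ← h1, ← h1] at h2
  calc _ = (fun z => invert ((LinearMap.toMatrix' Φ).col x z)) ⬝ᵥ
        (lam q).mulVec ((LinearMap.toMatrix' Φ).col y) := by
        rw [Matrix.mul_assoc, Matrix.mul_apply]; rfl
    _ = _ := by
      rw [h2]
      simp only [dotProduct, Pi.single_apply, apply_ite invert, map_one, map_zero, ite_mul, one_mul,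
        zero_mul]
      simp

/-- A basis of a Lagrangian submodule extends to a symplectic basis of the Pauli module. -/
lemma exists_symplectic_of_basis {n : ℕ}
    {K : Submodule (LaurentPolynomial (ZMod 2)) (PauliModule ℤ q)} (hK : K = perp K)
    (b : Module.Basis (Fin n) (LaurentPolynomial (ZMod 2)) K) :
    n = q ∧ ∃ Φ : PauliModule ℤ q →ₗ[LaurentPolynomial (ZMod 2)] PauliModule ℤ n,
      Function.Surjective Φ ∧ (∀ u v, omega (Φ u) (Φ v) = omega u v) ∧
      ∀ i, Φ (b i) = Pi.single (Sum.inr i) 1 := by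
  have hiso : K ≤ perp K := hK.le
  have hsat : sat K ≤ K := (sat_le_perp_sat hiso).trans fun v hv => hK.ge fun u hu =>
    hv u (le_sat hu)
  have hfree := free_quotient hsat
  obtain ⟨s, hs⟩ := Module.projective_lifting_property K.mkQ LinearMap.id K.mkQ_surjective
  let p : PauliModule ℤ q →ₗ[LaurentPolynomial (ZMod 2)] K :=
    (LinearMap.id - s ∘ₗ K.mkQ).codRestrict K fun v => by
      have h1 := LinearMap.congr_fun hs (K.mkQ v)
      rw [← Submodule.Quotient.mk_eq_zero, ← Submodule.mkQ_apply]
      simp only [LinearMap.sub_apply, LinearMap.id_apply, LinearMap.comp_apply, map_sub] at h1 ⊢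
      rw [h1, sub_self]
  have hp : ∀ k : K, p k = k := fun k => Subtype.ext (by
    have h1 : K.mkQ (k : PauliModule ℤ q) = 0 := by
      rw [Submodule.mkQ_apply, Submodule.Quotient.mk_eq_zero]; exact k.2
    simp only [p, LinearMap.codRestrict_apply, LinearMap.sub_apply, LinearMap.comp_apply, h1,
      map_zero, sub_zero, LinearMap.id_apply])
  -- The retraction `p` onto `K` extends the coordinate functionals to `P`; the vectors representing
  -- them are dual to `b` but not yet mutually orthogonal.
  choose c hc using fun i => exists_eq_omega (b.coord i ∘ₗ p)
  have hbb : ∀ i j, omega (b i : PauliModule ℤ q) (b j) = 0 := fun i j => hiso (b j).2 _ (b i).2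
  have hcb : ∀ i j, omega (c i) (b j) = if i = j then 1 else 0 := fun i j => by
    rw [← hc, LinearMap.comp_apply, hp, Module.Basis.coord_apply, Module.Basis.repr_self,
      Finsupp.single_apply]
    simp only [eq_comm]
  have hbc : ∀ i j, omega (b i : PauliModule ℤ q) (c j) = if i = j then 1 else 0 := fun i j => by
    rw [omega_comm, hcb]
    simp only [apply_ite (antipode ℤ), map_one, map_zero, eq_comm]
  let f : Fin n → LaurentPolynomial (ZMod 2) := fun i =>
    ∑ l, antipode ℤ (c i (Sum.inl l)) * c i (Sum.inr l)
  -- The form is even: its diagonal values are traces `f + f̄`. This is what allows the diagonal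
  -- correction below in characteristic two.
  have hf : ∀ i, omega (c i) (c i) = f i + antipode ℤ (f i) := fun i => by
    simp only [omega, f, map_sum, map_mul, antipode_antipode, ← Finset.sum_add_distrib]
    exact Finset.sum_congr rfl fun l _ => by ring
  -- Adding multiples of the `b j` preserves duality and changes `omega (c i) (c j)` by `a j i` plus
  -- the antipode of `a i j`; a lower triangular `a` cancels each pair once.
  let a : Fin n → Fin n → LaurentPolynomial (ZMod 2) := fun i j =>
    if j < i then omega (c j) (c i) else if i = j then f i else 0
  let d : Fin n → PauliModule ℤ q := fun i => c i + ∑ j, a i j • (b j : PauliModule ℤ q)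
  have two : ∀ r : LaurentPolynomial (ZMod 2), r + r = 0 := fun r => by
    ext m; simp [CharTwo.add_self_eq_zero]
  have hdb : ∀ i j, omega (d i) (b j) = if i = j then 1 else 0 := fun i j => by
    simp only [d, omega_add_left, omega_sum_left, omega_smul_left, hbb, mul_zero,
      Finset.sum_const_zero, add_zero, hcb]
  have hbd : ∀ i j, omega (b i : PauliModule ℤ q) (d j) = if i = j then 1 else 0 := fun i j => by
    rw [omega_comm, hdb]
    simp only [apply_ite (antipode ℤ), map_one, map_zero, eq_comm]
  have hdd : ∀ i j, omega (d i) (d j) = 0 := fun i j => by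
    have h1 : omega (d i) (d j) = omega (c i) (c j) + a j i + antipode ℤ (a i j) := by
      conv_lhs => rw [show d j = c j + ∑ k, a j k • (b k : PauliModule ℤ q) from rfl]
      simp only [omega_add_right, omega_sum_right, omega_smul_right, hdb]
      simp only [d, omega_add_left, omega_sum_left, omega_smul_left, hbc]
      simp only [mul_ite, mul_one, mul_zero, Finset.sum_ite_eq, Finset.sum_ite_eq',
        Finset.mem_univ, if_true]
      ring
    rw [h1]
    rcases lt_trichotomy i j with h | rfl | h
    · simp only [a, if_pos h, if_neg h.not_gt, if_neg h.ne, map_zero, two]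
    · simp only [a, lt_irrefl, if_false, if_true, hf]
      linear_combination two (f i) + two (antipode ℤ (f i))
    · simp only [a, if_pos h, if_neg h.not_gt, if_neg h.ne, add_zero]
      rw [← omega_comm, two]
  let Φ : PauliModule ℤ q →ₗ[LaurentPolynomial (ZMod 2)] PauliModule ℤ n :=
    LinearMap.pi (Sum.elim (fun i => omegaRight (b i : PauliModule ℤ q)) fun i => omegaRight (d i))
  let Ψ : PauliModule ℤ n → PauliModule ℤ q := fun A =>
    ∑ i, (A (Sum.inr i) • (b i : PauliModule ℤ q) + A (Sum.inl i) • d i)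
  have hΦl : ∀ v i, Φ v (Sum.inl i) = omega (b i : PauliModule ℤ q) v := fun v i => rfl
  have hΦr : ∀ v i, Φ v (Sum.inr i) = omega (d i) v := fun v i => rfl
  have hΦΨ : ∀ A, Φ (Ψ A) = A := fun A => by
    ext1 x
    rcases x with i | i
    · simp only [hΦl, Ψ, omega_sum_right, omega_add_right, omega_smul_right, hbb, hbd]
      simp
    · simp only [hΦr, Ψ, omega_sum_right, omega_add_right, omega_smul_right, hdb, hdd]
      simp
  have hsum : ∀ v (hv : v ∈ K), v = ∑ i, b.repr ⟨v, hv⟩ i • (b i : PauliModule ℤ q) :=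
    fun v hv => by
      have h1 := congrArg K.subtype (b.sum_repr ⟨v, hv⟩)
      rw [map_sum] at h1
      exact h1.symm
  have hinj : Function.Injective Φ := by
    rw [← LinearMap.ker_eq_bot, LinearMap.ker_eq_bot']
    intro v hv
    have hvK : v ∈ K := by
      rw [hK]
      intro u hu
      have h2 := hsum u hu
      rw [h2, omega_sum_left]
      refine Finset.sum_eq_zero fun i _ => ?_
      rw [omega_smul_left, ← hΦl, hv]
      simp
    have h2 := hsum v hvK
    have h3 : ∀ j, b.repr ⟨v, hvK⟩ j = 0 := fun j => by
      have h4 := congrFun hv (Sum.inr j)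
      rw [hΦr, h2] at h4
      simpa [omega_sum_right, omega_smul_right, hdb] using h4
    rw [h2]
    simp [h3]
  have hsurj : Function.Surjective Φ := fun A => ⟨Ψ A, hΦΨ A⟩
  refine ⟨?_, Φ, hsurj, fun u v => ?_, fun i => ?_⟩
  · have := card_eq_of_linearEquiv _ (LinearEquiv.ofBijective Φ ⟨hinj, hsurj⟩)
    simp only [Fintype.card_sum, Fintype.card_fin] at this
    omega
  · have h1 : ∀ A v, omega (Ψ A) v = omega A (Φ v) := fun A v => by
      simp only [Ψ, omega_sum_left, omega_add_left, omega_smul_left]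
      exact Finset.sum_congr rfl fun i _ => by rw [hΦl, hΦr, add_comm]
    rw [← h1, hinj (hΦΨ (Φ u))]
  · ext1 x
    rcases x with j | j
    · rw [hΦl, hbb]; simp
    · rw [hΦr, hdb]
      simp [Pi.single_apply]

end Symplectic

/-! ### Coarse-graining -/

section CoarseGrain

open LaurentPolynomial

variable {q : ℕ} (c : ℕ) [NeZero c]

/-- The old qubit and the position in the block of a new qubit. -/
def blockIndex (x : Fin (c * q) ⊕ Fin (c * q)) : Fin c × (Fin q ⊕ Fin q) :=
  x.elim (fun k => ((finProdFinEquiv.symm k).1, Sum.inl (finProdFinEquiv.symm k).2))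
    fun k => ((finProdFinEquiv.symm k).1, Sum.inr (finProdFinEquiv.symm k).2)

omit [NeZero c] in
lemma blockIndex_bijective : Function.Bijective (blockIndex c (q := q)) := by
  constructor
  · rintro (k | k) (l | l) h
    all_goals simp only [blockIndex, Sum.elim_inl, Sum.elim_inr, Prod.mk.injEq, Sum.inl.injEq,
      Sum.inr.injEq, reduceCtorEq, and_false] at h
    all_goals rw [finProdFinEquiv.symm.injective (Prod.ext h.1 h.2)]
  · rintro ⟨r, i | i⟩
    · exact ⟨Sum.inl (finProdFinEquiv (r, i)), by
        simp only [blockIndex, Sum.elim_inl, Equiv.symm_apply_apply]⟩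
    · exact ⟨Sum.inr (finProdFinEquiv (r, i)), by
        simp only [blockIndex, Sum.elim_inr, Equiv.symm_apply_apply]⟩

lemma coeff_coarseGrain (v : PauliModule ℤ q) (x : Fin (c * q) ⊕ Fin (c * q)) (n : ℤ) :
    (coarseGrain c v x).coeff n =
      (v (blockIndex c x).2).coeff (c * n + ((blockIndex c x).1 : ℕ)) := by
  rcases x with k | k <;> rfl

lemma coarseGrain_add (u v : PauliModule ℤ q) :
    coarseGrain c (u + v) = coarseGrain c u + coarseGrain c v := by
  ext x n; simp [coeff_coarseGrain]

/-- Coarse-graining as an additive map. -/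
def coarseGrainHom : PauliModule ℤ q →+ PauliModule ℤ (c * q) :=
  AddMonoidHom.mk' (coarseGrain c) (coarseGrain_add c)

lemma coarseGrain_single (x : Fin (c * q) ⊕ Fin (c * q)) (n : ℤ) (a : ZMod 2) :
    coarseGrain c (Pi.single (blockIndex c x).2
      (single (c * n + ((blockIndex c x).1 : ℕ)) a)) = Pi.single x (single n a) := by
  classical
  have hc : (0 : ℤ) < c := by exact_mod_cast NeZero.pos c
  ext y m
  rw [coeff_coarseGrain]
  by_cases hy : y = x
  · subst hy
    rw [Pi.single_eq_same, Pi.single_eq_same, AddMonoidAlgebra.coeff_single,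
      AddMonoidAlgebra.coeff_single, Finsupp.single_apply, Finsupp.single_apply]
    simp [NeZero.ne c]
  · rw [Pi.single_eq_of_ne hy]
    by_cases h2 : (blockIndex c y).2 = (blockIndex c x).2
    · rw [h2, Pi.single_eq_same, AddMonoidAlgebra.coeff_single, Finsupp.single_apply, if_neg]
      · simp
      · intro h
        apply hy
        apply (blockIndex_bijective c).1
        refine Prod.ext (Fin.ext ?_) h2
        have h3 := congrArg (· % (c : ℤ)) h
        simp only [Int.mul_add_emod_self_left] at h3
        have h4 := (blockIndex c x).1.2
        have h5 := (blockIndex c y).1.2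
        rw [Int.emod_eq_of_lt (by omega) (by omega), Int.emod_eq_of_lt (by omega) (by omega)] at h3
        exact_mod_cast h3.symm
    · rw [Pi.single_eq_of_ne h2]; rfl

lemma exists_blockIndex (i : Fin q ⊕ Fin q) (n : ℤ) :
    ∃ x m, (blockIndex c x).2 = i ∧ (c : ℤ) * m + ((blockIndex c x).1 : ℕ) = n := by
  have hc : (0 : ℤ) < c := by exact_mod_cast NeZero.pos c
  have h1 := Int.emod_nonneg n hc.ne'
  have h2 := Int.emod_lt_of_pos n hc
  obtain ⟨x, hx⟩ := (blockIndex_bijective c).2 (⟨(n % c).toNat, by omega⟩, i)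
  refine ⟨x, n / c, by rw [hx], ?_⟩
  rw [hx]
  have h3 := Int.mul_ediv_add_emod n c
  simp only [Int.toNat_of_nonneg h1]
  exact h3

lemma coarseGrain_injective : Function.Injective (coarseGrain c (q := q)) := by
  intro u v h
  ext i n
  obtain ⟨x, m, rfl, rfl⟩ := exists_blockIndex c i n
  rw [← coeff_coarseGrain, ← coeff_coarseGrain, h]

lemma coarseGrain_surjective : Function.Surjective (coarseGrain c (q := q)) := by
  classical
  intro w
  change w ∈ (coarseGrainHom c).range
  rw [← Finset.univ_sum_single w]
  refine sum_mem fun x _ => ?_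
  induction w x using AddMonoidAlgebra.induction_linear with
  | zero => simp
  | add f g hf hg => rw [Pi.single_add]; exact add_mem hf hg
  | single n a => exact ⟨_, coarseGrain_single c x n a⟩

lemma bform_single_left {q : ℕ} (x : Fin q ⊕ Fin q) (n : ℤ) (a : ZMod 2) (v : PauliModule ℤ q) :
    bform (Pi.single x (single n a)) v = a * (v x.swap).coeff n := by
  rw [bform_comm, bform, omega_single, ← coeff_zero_antipode, map_mul, antipode_antipode, mul_comm,
    coeff_antipode_mul, AddMonoidAlgebra.coeff_single, Finsupp.sum_single_index (zero_mul _)]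

omit [NeZero c] in
lemma blockIndex_swap (x : Fin (c * q) ⊕ Fin (c * q)) :
    blockIndex c x.swap = ((blockIndex c x).1, (blockIndex c x).2.swap) := by
  rcases x with k | k <;> rfl

/-- Coarse-graining only relabels qubits, so it preserves commutation signs. This is expressed
through `bform` because `omega` changes with the translation group. -/
lemma bform_coarseGrain (u v : PauliModule ℤ q) :
    bform (coarseGrain c u) (coarseGrain c v) = bform u v := by
  classical
  let f : PauliModule ℤ q →+ ZMod 2 :=
    AddMonoidHom.mk' (fun u => bform (coarseGrain c u) (coarseGrain c v)) fun u u' => by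
      rw [coarseGrain_add, bform_add_left]
  let g : PauliModule ℤ q →+ ZMod 2 :=
    AddMonoidHom.mk' (fun u => bform u v) fun u u' => bform_add_left _ _ _
  suffices h : f = g from DFunLike.congr_fun h u
  refine AddMonoidHom.functions_ext' _ _ _ fun i => AddMonoidAlgebra.addMonoidHom_ext fun n a => ?_
  obtain ⟨x, m, rfl, rfl⟩ := exists_blockIndex c i n
  change bform (coarseGrain c (Pi.single _ _)) (coarseGrain c v) = bform (Pi.single _ _) v
  rw [coarseGrain_single, bform_single_left, bform_single_left, coeff_coarseGrain,
    blockIndex_swap]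

/-- The substitution `x ↦ x^c`. -/
def expand : LaurentPolynomial (ZMod 2) →+* LaurentPolynomial (ZMod 2) :=
  AddMonoidAlgebra.mapDomainRingHom (ZMod 2) (AddMonoidHom.mulLeft (c : ℤ))

omit [NeZero c] in
lemma expand_single (n : ℤ) (a : ZMod 2) : expand c (single n a) = single (c * n) a :=
  AddMonoidAlgebra.mapDomain_single

lemma expand_injective : Function.Injective (expand c) :=
  AddMonoidAlgebra.mapDomain_injective fun m n h => by
    have hc : (c : ℤ) ≠ 0 := by exact_mod_cast NeZero.ne c
    exact mul_left_cancel₀ hc h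

lemma smul_coarseGrain (r : LaurentPolynomial (ZMod 2)) (v : PauliModule ℤ q) :
    r • coarseGrain c v = coarseGrain c (expand c r • v) := by
  induction r using AddMonoidAlgebra.induction_linear with
  | zero =>
    rw [map_zero, zero_smul, zero_smul]
    exact ((coarseGrainHom c).map_zero).symm
  | add f g hf hg => rw [map_add, add_smul, add_smul, coarseGrain_add, hf, hg]
  | single n a =>
    ext x m
    rw [expand_single, coeff_coarseGrain, Pi.smul_apply, Pi.smul_apply, smul_eq_mul, smul_eq_mul,
      AddMonoidAlgebra.coeff_single_mul_apply, AddMonoidAlgebra.coeff_single_mul_apply,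
      coeff_coarseGrain]
    congr 2
    ring

/-- The coarse-grained module. -/
def coarseGrainModule (S : Submodule (LaurentPolynomial (ZMod 2)) (PauliModule ℤ q)) :
    Submodule (LaurentPolynomial (ZMod 2)) (PauliModule ℤ (c * q)) where
  carrier := coarseGrain c '' S
  add_mem' := by
    rintro _ _ ⟨u, hu, rfl⟩ ⟨v, hv, rfl⟩
    exact ⟨u + v, add_mem hu hv, coarseGrain_add c u v⟩
  zero_mem' := ⟨0, zero_mem S, (coarseGrainHom c).map_zero⟩
  smul_mem' := by
    rintro r _ ⟨u, hu, rfl⟩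
    exact ⟨_, S.smul_mem _ hu, (smul_coarseGrain c r u).symm⟩

variable {S : Submodule (LaurentPolynomial (ZMod 2)) (PauliModule ℤ q)}

lemma coarseGrain_mem {v : PauliModule ℤ q} :
    coarseGrain c v ∈ coarseGrainModule c S ↔ v ∈ S :=
  (coarseGrain_injective c).mem_set_image

lemma mem_perp_iff_bform {q : ℕ} {S : Submodule (LaurentPolynomial (ZMod 2)) (PauliModule ℤ q)}
    {v : PauliModule ℤ q} : v ∈ perp S ↔ ∀ u ∈ S, bform u v = 0 := by
  constructor
  · intro h u hu
    simp [bform, h u hu]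
  · intro h u hu
    exact omega_eq_zero_iff.mpr fun g => h _ (S.smul_mem _ hu)

lemma perp_coarseGrainModule :
    perp (coarseGrainModule c S) = coarseGrainModule c (perp S) := by
  ext w
  obtain ⟨v, rfl⟩ := coarseGrain_surjective c w
  rw [coarseGrain_mem, mem_perp_iff_bform, mem_perp_iff_bform]
  constructor
  · intro h u hu
    rw [← bform_coarseGrain c]
    exact h _ ((coarseGrain_mem c).mpr hu)
  · rintro h _ ⟨u, hu, rfl⟩
    rw [bform_coarseGrain]
    exact h u hu

lemma coarseGrainModule_mono {S' : Submodule (LaurentPolynomial (ZMod 2)) (PauliModule ℤ q)}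
    (h : S ≤ S') : coarseGrainModule c S ≤ coarseGrainModule c S' := Set.image_mono h

/-- Translation by one coarse site is translation by `c` old sites. -/
lemma T_sub_one_smul_mem_coarseGrainModule
    (h : ∀ v ∈ sat S, (T (c : ℤ) - 1 : LaurentPolynomial (ZMod 2)) • v ∈ S) :
    ∀ w ∈ sat (coarseGrainModule c S),
      (T 1 - 1 : LaurentPolynomial (ZMod 2)) • w ∈ coarseGrainModule c S := by
  rintro w ⟨r, hr, hw⟩
  obtain ⟨v, rfl⟩ := coarseGrain_surjective c w
  rw [smul_coarseGrain, coarseGrain_mem] at hw ⊢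
  have h1 : expand c (T 1 - 1) = T c - 1 := by
    rw [map_sub, map_one, T, expand_single, mul_one, T]
  rw [h1]
  exact h v ⟨_, (map_ne_zero_iff _ (expand_injective c)).mpr hr, hw⟩

end CoarseGrain

/-! ### The normal form -/

section NormalForm

open LaurentPolynomial

variable {q t : ℕ}

/-- A finite type with a marked subset, and a marked subset of that one, can be listed in order. -/
lemma exists_ordering {n p : ℕ} (f : Fin p ↪ Fin n) (P : Fin p → Prop) :
    ∃ (k m l : ℕ) (e : Fin (k + m + l) ≃ Fin n) (g : Fin (k + m) ≃ Fin p),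
      (∀ j, f (g j) = e (Fin.castAdd l j)) ∧ ∀ j : Fin (k + m), (j : ℕ) < k ↔ P (g j) := by
  classical
  let e₁ := Fintype.equivFin {i // P i}
  let e₂ := Fintype.equivFin {i // ¬ P i}
  let e₃ := Fintype.equivFin {i // i ∉ Set.range f}
  let g := (finSumFinEquiv.symm.trans (Equiv.sumCongr e₁.symm e₂.symm)).trans (Equiv.sumCompl P)
  let e := (finSumFinEquiv.symm.trans (Equiv.sumCongr (g.trans (Equiv.ofInjective f f.injective))
    e₃.symm)).trans (Equiv.sumCompl (· ∈ Set.range f))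
  refine ⟨_, _, _, e, g, fun j => ?_, fun j => ?_⟩
  · simp [e]
  · refine Fin.addCases (fun i => ?_) (fun i => ?_) j
    · simpa [g] using (e₁.symm i).2
    · simpa [g] using (e₂.symm i).2

/-- The stabilizer module together with the number of qubits per site. -/
def chainModule (H : CodeHamiltonian ℤ q t) : ChainModule := ⟨q, H.stabilizerModule⟩

/-- After coarse-graining, a symplectic transformation brings an isotropic module to normal form. -/
lemma exists_move_ising {S : Submodule (LaurentPolynomial (ZMod 2)) (PauliModule ℤ q)}
    (hS : S ≤ perp S) (h : ∀ v ∈ sat S, (T 1 - 1 : LaurentPolynomial (ZMod 2)) • v ∈ S) :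
    ∃ k m f : ℕ, Move ⟨q, S⟩ (chainModule (isingChains k m f)) ∧
      (perp S ≤ S → perp (isingChains k m f).stabilizerModule ≤
        (isingChains k m f).stabilizerModule) := by
  obtain ⟨K, hSK, hK⟩ := exists_lagrangian hS
  obtain ⟨n, p, b, f, a, ha, hspan⟩ := exists_basis_of_T_sub_one_smul hSK h
  obtain ⟨k, m, l, e, g, hfg, hk⟩ := exists_ordering f fun i => a i = 1 + T 1
  obtain ⟨rfl, Φ, hsurj, hΦ, hΦb⟩ := exists_symplectic_of_basis hK (b.reindex e.symm)
  have hmap : S.map Φ = (isingChains k m l).stabilizerModule := by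
    rw [hspan, Submodule.map_span, CodeHamiltonian.stabilizerModule]
    congr 1
    rw [← Set.range_comp, ← g.surjective.range_comp]
    congr 1
    funext j
    have h1 := hΦb (Fin.castAdd l j)
    rw [Module.Basis.reindex_apply, Equiv.symm_symm, ← hfg] at h1
    have h2 : a (g j) = if (j : ℕ) < k then 1 + T 1 else 1 := by
      split_ifs with hj
      · exact (hk j).mp hj
      · exact (ha (g j)).resolve_right fun h3 => hj ((hk j).mpr h3)
    simp only [Function.comp_apply]
    rw [map_smul, h1, h2]
    funext x
    rcases x with i | i
    · simp [isingChains, isingGen, Matrix.col]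
    · simp [isingChains, isingGen, Matrix.col, Pi.single_apply]
  refine ⟨k, m, l, ?_, fun hperp => ?_⟩
  · have h1 := Move.symplectic S _ (isSymplectic_toMatrix' Φ hΦ)
    have h2 : (LinearMap.toMatrix' Φ).mulVecLin = Φ := by
      rw [← Matrix.toLin'_apply', Matrix.toLin'_toMatrix']
    rw [h2, hmap] at h1
    exact h1
  · rw [← hmap]
    intro w hw
    obtain ⟨v, rfl⟩ := hsurj w
    -- A surjective isometry carries orthogonal complements to orthogonal complements.
    exact Submodule.mem_map_of_mem (hperp fun u hu => by
      rw [← hΦ]; exact hw _ (Submodule.mem_map_of_mem hu))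

lemma exists_reflTransGen_ising {S : Submodule (LaurentPolynomial (ZMod 2)) (PauliModule ℤ q)}
    (hS : S ≤ perp S) :
    ∃ k m f : ℕ, Relation.ReflTransGen Move ⟨q, S⟩ (chainModule (isingChains k m f)) ∧
      (perp S ≤ S → perp (isingChains k m f).stabilizerModule ≤
        (isingChains k m f).stabilizerModule) := by
  obtain ⟨c, hc, h⟩ := exists_T_sub_one_smul_mem S
  have : NeZero c := ⟨hc.ne'⟩
  have hS' : coarseGrainModule c S ≤ perp (coarseGrainModule c S) := by
    rw [perp_coarseGrainModule]; exact coarseGrainModule_mono c hS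
  obtain ⟨k, m, f, hmove, hperp⟩ :=
    exists_move_ising hS' (T_sub_one_smul_mem_coarseGrainModule c h)
  refine ⟨k, m, f, (Relation.ReflTransGen.single
    (Move.coarseGraining c S (coarseGrainModule c S) rfl)).tail hmove, fun hle => hperp ?_⟩
  rw [perp_coarseGrainModule]
  exact coarseGrainModule_mono c hle

/-- Every single-qubit `σ_z` commutes with all terms, so it would be a stabilizer. But the
`σ_z`-components of stabilizers are multiples of `1 + x` on an Ising qubit and zero on a free one.
-/
lemma isingChains_eq_zero_of_perp_le {k m f : ℕ}
    (h : perp (isingChains k m f).stabilizerModule ≤ (isingChains k m f).stabilizerModule) :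
    k = 0 ∧ f = 0 := by
  have hmem : ∀ i, (Pi.single (Sum.inr i) 1 : PauliModule ℤ (k + m + f)) ∈
      (isingChains k m f).stabilizerModule := fun i => h (by
    rw [CodeHamiltonian.mem_perp_iff_omega]
    intro j
    rw [omega_single]
    simp [isingChains, isingGen, Matrix.col])
  have hspan : ∀ (i : Fin (k + m + f)) (d : LaurentPolynomial (ZMod 2)),
      (∀ j, d ∣ (isingGen k m f).col j (Sum.inr i)) → d ∣ 1 := by
    intro i d hd
    have hle : (isingChains k m f).stabilizerModule ≤
        Submodule.comap
        (LinearMap.proj (φ := fun _ => LaurentPolynomial (ZMod 2)) (Sum.inr i)) (Ideal.span {d}) := by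
      refine Submodule.span_le.mpr ?_
      rintro _ ⟨j, rfl⟩
      exact Ideal.mem_span_singleton.mpr (hd j)
    have := Ideal.mem_span_singleton.mp (hle (hmem i))
    simpa using this
  constructor
  · by_contra hk
    have h1 := hspan (Fin.castAdd f (Fin.castAdd m ⟨0, Nat.pos_of_ne_zero hk⟩)) (1 + T 1)
      fun j => by
        simp only [Matrix.col, isingGen, Matrix.transpose_apply, Matrix.of_apply]
        split_ifs with h1 h2
        · rfl
        · exact absurd (Fin.castAdd_injective _ _ h1 ▸ Nat.pos_of_ne_zero hk) h2
        · exact dvd_zero _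
    rw [one_add_T_eq] at h1
    exact irreducible_T_sub_one.not_isUnit (isUnit_iff_dvd_one.mpr h1)
  · by_contra hf
    have h1 := hspan (Fin.natAdd (k + m) ⟨0, Nat.pos_of_ne_zero hf⟩) 0 fun j => by
      simp only [Matrix.col, isingGen, Matrix.transpose_apply, Matrix.of_apply]
      rw [if_neg]
      intro h1
      have := congrArg Fin.val h1
      simp at this
      omega
    exact one_ne_zero (zero_dvd_iff.mp h1)

lemma CodeHamiltonian.IsExact.perp_le {H : CodeHamiltonian ℤ q t} (h : H.IsExact) :
    perp H.stabilizerModule ≤ H.stabilizerModule := by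
  intro v hv
  have h1 : (dagger H.gen * lam q).mulVec v = 0 := by
    ext1 i
    rw [← Matrix.mulVec_mulVec]
    refine Eq.trans ?_ (H.mem_perp_iff_omega.mp hv i)
    rw [omega_eq_dotProduct]
    rfl
  obtain ⟨w, rfl⟩ := (h v).mp h1
  rw [CodeHamiltonian.stabilizerModule, ← Matrix.range_mulVecLin]
  exact ⟨w, rfl⟩

end NormalForm

end PauliCode

end

theorem mainTheorem4 {q t : ℕ} (H : PauliCode.CodeHamiltonian ℤ q t) :
    (∃ k m f : ℕ, PauliCode.Equivalent H (PauliCode.isingChains k m f)) ∧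
    (∃ L₀ : ℕ, ∀ (L : ℕ) [NeZero L], L₀ ≤ L →
      ∀ H_L : PauliCode.CodeHamiltonian (ZMod L) q t, PauliCode.IsPeriodic H L H_L →
        1 < Module.finrank ℂ H_L.groundSpace → ¬ H_L.TopologicallyOrdered) ∧
    ((¬ ∃ m : ℕ, PauliCode.Equivalent H (PauliCode.isingChains 0 m 0)) →
      ¬ H.IsExact ∧
      ∀ N : ℕ, ∃ L : ℕ, ∃ _ : NeZero L, N ≤ L ∧
        ∀ H_L : PauliCode.CodeHamiltonian (ZMod L) q t, PauliCode.IsPeriodic H L H_L →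
          1 < Module.finrank ℂ H_L.groundSpace ∧ ¬ H_L.TopologicallyOrdered) := by
  open PauliCode in
  obtain ⟨k, m, f, hmoves, hperp⟩ := exists_reflTransGen_ising H.stabilizerModule_le_perp
  have hequiv : Equivalent H (isingChains k m f) := ⟨_, hmoves, .refl⟩
  obtain ⟨L₀, hL₀⟩ := H.exists_not_topologicallyOrdered
  refine ⟨⟨k, m, f, hequiv⟩, ⟨L₀, hL₀⟩, fun hne => ?_⟩
  have hnot : ¬ perp H.stabilizerModule ≤ H.stabilizerModule := fun hle => by
    obtain ⟨rfl, rfl⟩ := isingChains_eq_zero_of_perp_le (hperp hle)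
    exact hne ⟨m, hequiv⟩
  refine ⟨fun hex => hnot hex.perp_le, fun N => ?_⟩
  obtain ⟨v, hv, hvS⟩ := SetLike.not_le_iff_exists.mp hnot
  -- Beyond `L₀`, degeneracy already excludes topological order.
  obtain ⟨L, hL, hN, hdeg⟩ := exists_one_lt_finrank hv hvS (max N L₀)
  exact ⟨L, hL, (le_max_left _ _).trans hN, fun H_L hper =>
    ⟨hdeg H_L hper, hL₀ L ((le_max_right _ _).trans hN) H_L hper (hdeg H_L hper)⟩⟩
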